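/- Let $k\ge 0$ be an integer and let $\mathcal C_k$ be the unital commutative complex algebra $\mathbb C^{k+1}$ with the product $(\alpha\cdot\beta)^{(i)}=\sum_{j=0}^{i}\binom ij\alpha^{(j)}\beta^{(i-j)}$, $0\le i\le k$, and unit $(1,0,\dots,0)$. Let $(\mathcal A,\tilde\varphi)$ be a scarce $\mathcal C_k$-noncommutative probability space: $\mathcal A$ is a unital complex algebra and $\tilde\varphi:\mathcal A\to\mathcal C_k$ is a linear map with $\tilde\varphi(1_{\mathcal A})=1_{\mathcal C_k}$. For $n\ge1$ let $NC(n)$ be the set of non-crossing partitions of $[n]=\{1<\dots<n\}$. For $p\in NC(n)$, the Kreweras complement $\mathrm{Kr}(p)\in NC(n)$ is the biggest partition (for the order in which $q\preceq q'$ if every block of $q$ is contained in a block of $q'$) of a copy $\{\bar1<\dots<\bar n\}$ of $[n]$ such that $p\cup\mathrm{Kr}(p)$ is a non-crossing partition of $\{1<\bar1<2<\bar2<\dots<n<\bar n\}$. For a family of multilinear maps $r_m:\mathcal A^m\to\mathcal C_k$, $m\ge 1$, and $p\in NC(n)$, put $$r_p(a_1,\dots,a_n)=\prod_{V=\{v_1<\dots<v_m\}\in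 p}r_m(a_{v_1},\dots,a_{v_m}).$$ The $\mathcal C_k$-non-crossing cumulant functionals of $(\mathcal A,\tilde\varphi)$ are the multilinear maps $\tilde\kappa_n:\mathcal A^n\to\mathcal C_k$, $n\ge1$, uniquely determined by $$\sum_{p\in NC(n)}\tilde\kappa_p(a_1,\dots,a_n)=\tilde\varphi(a_1\cdots a_n)\qquad(n\ge1,\ a_1,\dots,a_n\in\mathcal A).$$ Subsets $\mathcal M_1,\mathcal M_2\subseteq\mathcal A$ are infinitesimally free of order $k$ if $\tilde\kappa_m(c_1,\dots,c_m)=0$ whenever $c_1\in\mathcal M_{i_1},\dots,c_m\in\mathcal M_{i_m}$ and the indices $i_1,\dots,i_m\in\{1,2\}$ are not all equal. Proposition. If $\mathcal M_1,\mathcal M_2\subseteq\mathcal A$ are infinitesimally free of order $k$, then for every $n\ge1$ and all $(a_1,\dots,a_n)\in\mathcal M_1^n$ and $(b_1,\dots,b_n)\in\mathcal M_2^n$, $$\tilde\kappa_n(a_1b_1,\dots,a_nb_n)=\sum_{p\in NC(n)}\tilde\kappa_p(a_1,\dots,a_n)\cdot\tilde\kappa_{\mathrm{Kr}(p)}(b_1,\dots,b_n).$$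 -/

import Mathlib

open Finset

/-! ### The algebra `𝒞_k` -/

/-- The vector space `ℂ^{k+1}`, which is going to carry the multiplication
`(α β)^{(i)} = ∑_{j=0}^{i} (i choose j) α^{(j)} β^{(i-j)}`. -/
def CAlg (k : ℕ) : Type := Fin (k + 1) → ℂ

namespace CAlg

variable {k : ℕ}

instance : AddCommGroup (CAlg k) := inferInstanceAs (AddCommGroup (Fin (k + 1) → ℂ))

noncomputable instance : Module ℂ (CAlg k) := inferInstanceAs (Module ℂ (Fin (k + 1) → ℂ))

@[ext] theorem ext {α β : CAlg k} (h : ∀ i, α i = β i) : α = β := funext h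

@[simp] theorem add_apply (α β : CAlg k) (i : Fin (k + 1)) : (α + β) i = α i + β i := rfl

@[simp] theorem zero_apply (i : Fin (k + 1)) : (0 : CAlg k) i = 0 := rfl

@[simp] theorem smul_apply (c : ℂ) (α : CAlg k) (i : Fin (k + 1)) : (c • α) i = c * α i := rfl

/-- The coordinate `α^{(j)}`, for `j` a natural number; only `j ≤ k` is meaningful. -/
def coord (α : CAlg k) (j : ℕ) : ℂ := if h : j < k + 1 then α ⟨j, h⟩ else 0

noncomputable instance : Mul (CAlg k) :=
  ⟨fun α β i => ∑ j ∈ range ((i : ℕ) + 1),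
    ((i : ℕ).choose j : ℂ) * α.coord j * β.coord ((i : ℕ) - j)⟩

noncomputable instance : One (CAlg k) := ⟨fun i => if i = 0 then 1 else 0⟩

theorem mul_apply (α β : CAlg k) (i : Fin (k + 1)) :
    (α * β) i = ∑ j ∈ range ((i : ℕ) + 1),
      ((i : ℕ).choose j : ℂ) * α.coord j * β.coord ((i : ℕ) - j) := rfl

theorem one_apply (i : Fin (k + 1)) : (1 : CAlg k) i = if i = 0 then 1 else 0 := rfl

theorem coord_val (α : CAlg k) (i : Fin (k + 1)) : α.coord i = α i := dif_pos i.2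

theorem coord_add (α β : CAlg k) (j : ℕ) : (α + β).coord j = α.coord j + β.coord j := by
  unfold coord; split_ifs <;> simp

theorem coord_smul (c : ℂ) (α : CAlg k) (j : ℕ) : (c • α).coord j = c * α.coord j := by
  unfold coord; split_ifs <;> simp

theorem coord_one (j : ℕ) : (1 : CAlg k).coord j = if j = 0 then 1 else 0 := by
  unfold coord
  split_ifs with h h' h'
  · subst h'; simp [one_apply]
  · rw [one_apply, if_neg]; intro e; exact h' (by simpa using congrArg Fin.val e)
  · omega
  · rfl

/-- The exponential generating series of the coordinates. -/
noncomputable def toPS (α : CAlg k) : PowerSeries ℂ :=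
  PowerSeries.mk fun n => α.coord n / (n.factorial : ℂ)

theorem mul_apply_eq (α β : CAlg k) (i : Fin (k + 1)) :
    (α * β) i = ((i : ℕ).factorial : ℂ) * PowerSeries.coeff (i : ℕ) (toPS α * toPS β) := by
  rw [mul_apply, PowerSeries.coeff_mul, Finset.Nat.sum_antidiagonal_eq_sum_range_succ_mk,
    Finset.mul_sum]
  refine Finset.sum_congr rfl fun j hj => ?_
  have hj' : j ≤ (i : ℕ) := by simpa [Nat.lt_succ_iff] using hj
  have h1 : ((j.factorial : ℕ) : ℂ) ≠ 0 := by exact_mod_cast j.factorial_ne_zero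
  have h2 : ((((i : ℕ) - j).factorial : ℕ) : ℂ) ≠ 0 := by
    exact_mod_cast ((i : ℕ) - j).factorial_ne_zero
  rw [Nat.cast_choose ℂ hj']
  simp only [toPS, PowerSeries.coeff_mk]
  field_simp

theorem coeff_toPS_mul (α β : CAlg k) {n : ℕ} (hn : n < k + 1) :
    PowerSeries.coeff n (toPS (α * β)) = PowerSeries.coeff n (toPS α * toPS β) := by
  have h1 : ((n.factorial : ℕ) : ℂ) ≠ 0 := by exact_mod_cast n.factorial_ne_zero
  have h := mul_apply_eq α β ⟨n, hn⟩
  simp only [toPS, PowerSeries.coeff_mk] at h ⊢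
  rw [coord, dif_pos hn, h]
  field_simp

protected theorem mul_comm' (α β : CAlg k) : α * β = β * α := by
  ext i; rw [mul_apply_eq, mul_apply_eq, mul_comm (toPS α)]

protected theorem mul_assoc' (α β γ : CAlg k) : α * β * γ = α * (β * γ) := by
  have key : ∀ (x y z : CAlg k) (i : Fin (k + 1)), (x * y * z) i
      = ((i : ℕ).factorial : ℂ) * PowerSeries.coeff (i : ℕ) (toPS x * toPS y * toPS z) := by
    intro x y z i
    rw [mul_apply_eq, PowerSeries.coeff_mul, PowerSeries.coeff_mul _ (toPS x * toPS y)]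
    congr 1
    refine Finset.sum_congr rfl fun p hp => ?_
    rw [coeff_toPS_mul]
    have := Finset.HasAntidiagonal.mem_antidiagonal.1 hp
    have := i.2
    omega
  ext i
  rw [CAlg.mul_comm' α (β * γ), key, key]
  congr 2; ring

protected theorem one_mul' (α : CAlg k) : 1 * α = α := by
  ext i
  rw [mul_apply, Finset.sum_eq_single 0]
  · simp [coord_one, coord_val]
  · intro j _ hj; simp [coord_one, hj]
  · simp

protected theorem add_mul' (α β γ : CAlg k) : (α + β) * γ = α * γ + β * γ := by
  ext i
  simp only [mul_apply, add_apply, coord_add, ← Finset.sum_add_distrib]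
  exact Finset.sum_congr rfl fun j _ => by ring

protected theorem smul_mul' (c : ℂ) (α β : CAlg k) : (c • α) * β = c • (α * β) := by
  ext i
  simp only [mul_apply, smul_apply, coord_smul, Finset.mul_sum]
  exact Finset.sum_congr rfl fun j _ => by ring

noncomputable instance : CommRing (CAlg k) where
  mul_assoc := CAlg.mul_assoc'
  one_mul := CAlg.one_mul'
  mul_one α := by rw [CAlg.mul_comm', CAlg.one_mul']
  mul_comm := CAlg.mul_comm'
  right_distrib := CAlg.add_mul'
  left_distrib α β γ := by
    rw [CAlg.mul_comm', CAlg.add_mul', CAlg.mul_comm' β, CAlg.mul_comm' γ]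
  zero_mul α := by
    have h := CAlg.smul_mul' 0 (0 : CAlg k) α
    simpa using h
  mul_zero α := by
    have h := CAlg.smul_mul' 0 (0 : CAlg k) α
    rw [CAlg.mul_comm']
    simpa using h
  zsmul := fun n α => n • α
  zsmul_zero' := SubNegMonoid.zsmul_zero'
  zsmul_succ' := SubNegMonoid.zsmul_succ'
  zsmul_neg' := SubNegMonoid.zsmul_neg'
  nsmul := fun n α => n • α
  nsmul_zero := AddMonoid.nsmul_zero
  nsmul_succ := AddMonoid.nsmul_succ
  neg_add_cancel := neg_add_cancel
  sub_eq_add_neg := sub_eq_add_neg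

noncomputable instance : Algebra ℂ (CAlg k) :=
  Algebra.ofModule CAlg.smul_mul' fun c α β => by
    rw [CAlg.mul_comm', CAlg.smul_mul', CAlg.mul_comm']

end CAlg

/-! ### Non-crossing partitions and the Kreweras complement -/

/-- `pos` lists the points of `X` in increasing order; the relation `r` ("being in the same block")
is non-crossing if `a < b < c < d`, `a ∼ c` and `b ∼ d` force `a ∼ b`. -/
def NonCrossingRel {X : Type*} (pos : X → ℕ) (r : X → X → Prop) : Prop :=
  ∀ a b c d : X, pos a < pos b → pos b < pos c → pos c < pos d → r a c → r b d → r a b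

/-- Two points are linked in a partition of `[n]` if they belong to the same block. -/
def Linked {n : ℕ} (p : Finpartition (univ : Finset (Fin n))) (x y : Fin n) : Prop :=
  ∃ V ∈ p.parts, x ∈ V ∧ y ∈ V

/-- `NC(n)`, the non-crossing partitions of `[n]`. -/
abbrev NC (n : ℕ) : Type :=
  {p : Finpartition (univ : Finset (Fin n)) // NonCrossingRel (fun x : Fin n => (x : ℕ)) (Linked p)}

noncomputable instance (n : ℕ) : Fintype (NC n) := Fintype.ofFinite _

/-- The order `1 < 1̄ < 2 < 2̄ < ⋯ < n < n̄` on `[n] ∪ [n̄]`, where `[n]` is the left and `[n̄]` the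
right summand. -/
def interleave {n : ℕ} : Fin n ⊕ Fin n → ℕ :=
  Sum.elim (fun i => 2 * (i : ℕ)) (fun i => 2 * (i : ℕ) + 1)

/-- `p ∪ q` is a non-crossing partition of `[n] ∪ [n̄]`, where `p` is a partition of `[n]` and `q` a
partition of `[n̄]`. -/
def UnionNonCrossing {n : ℕ} (p q : Finpartition (univ : Finset (Fin n))) : Prop :=
  NonCrossingRel interleave (Sum.LiftRel (Linked p) (Linked q))

theorem linked_iff_mem_part {n : ℕ} (p : Finpartition (univ : Finset (Fin n))) (x y : Fin n) :
    Linked p x y ↔ y ∈ p.part x := by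
  rw [Finpartition.mem_part_iff_exists]
  exact ⟨fun ⟨V, h, hx, hy⟩ => ⟨V, h, hy, hx⟩, fun ⟨V, h, hy, hx⟩ => ⟨V, h, hx, hy⟩⟩

theorem Linked.symm {n : ℕ} {p : Finpartition (univ : Finset (Fin n))} {x y : Fin n}
    (h : Linked p x y) : Linked p y x := by
  obtain ⟨V, hV, hx, hy⟩ := h; exact ⟨V, hV, hy, hx⟩

/-- Among the partitions `q` of `[n̄]` such that `p ∪ q` is non-crossing there is a biggest one. -/
theorem exists_isGreatest_unionNonCrossing {n : ℕ} (p : NC n) :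
    ∃ q : Finpartition (univ : Finset (Fin n)), IsGreatest {q | UnionNonCrossing p.1 q} q := by
  classical
  obtain ⟨p, hp⟩ := p
  let R : Fin n → Fin n → Prop := fun i j =>
    ∀ x y, Linked p x y → ((x ≤ i ↔ x ≤ j) ↔ (y ≤ i ↔ y ≤ j))
  let s : Setoid (Fin n) :=
    { r := R
      iseqv :=
        { refl := fun i x y _ => by tauto
          symm := fun {i j} h x y hxy => by have := h x y hxy; tauto
          trans := fun {i j l} h h' x y hxy => by
            have := h x y hxy
            have := h' x y hxy
            tauto } }
  have hs : ∀ i j, Linked (Finpartition.ofSetoid s) i j ↔ R i j := fun i j => by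
    rw [linked_iff_mem_part, Finpartition.mem_part_ofSetoid_iff_rel]; rfl
  refine ⟨Finpartition.ofSetoid s, ?_, ?_⟩
  · rintro (a | a) (b | b) (c | c) (d | d) hab hbc hcd hac hbd <;>
      simp only [interleave, Sum.elim_inl, Sum.elim_inr] at hab hbc hcd <;>
      simp only [Sum.liftRel_inl_inl, Sum.liftRel_inr_inr, Sum.not_liftRel_inl_inr,
        Sum.not_liftRel_inr_inl, hs] at hac hbd ⊢
    · exact hp a b c d (by simp; omega) (by simp; omega) (by simp; omega) hac hbd
    · have := hbd a c hac
      simp only [Fin.le_def] at this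
      omega
    · have := hac b d hbd
      simp only [Fin.le_def] at this
      omega
    · intro x y hxy
      have h1 := hac x y hxy
      have h2 := hbd x y hxy
      simp only [Fin.le_def] at h1 h2 ⊢
      omega
  · intro q hq
    have key : ∀ i j x y : Fin n, i < j → Linked q i j → Linked p x y →
        i < x → x ≤ j → i < y ∧ y ≤ j := by
      intro i j x y hij hl hxy hix hxj
      simp only [Fin.lt_def, Fin.le_def] at *
      by_contra hcon
      have : (y : ℕ) ≤ i ∨ (j : ℕ) < y := by omega
      rcases this with h | h
      · have := hq (Sum.inl y) (Sum.inr i) (Sum.inl x) (Sum.inr j)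
          (by simp [interleave]; omega) (by simp [interleave]; omega)
          (by simp [interleave]; omega) (Sum.LiftRel.inl hxy.symm) (Sum.LiftRel.inr hl)
        simp at this
      · have := hq (Sum.inr i) (Sum.inl x) (Sum.inr j) (Sum.inl y)
          (by simp [interleave]; omega) (by simp [interleave]; omega)
          (by simp [interleave]; omega) (Sum.LiftRel.inr hl) (Sum.LiftRel.inl hxy)
        simp at this
    have key' : ∀ i j : Fin n, i < j → Linked q i j → R i j := by
      intro i j hij hl x y hxy
      have h1 := key i j x y hij hl hxy
      have h2 := key i j y x hij hl hxy.symm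
      simp only [Fin.lt_def, Fin.le_def] at *
      omega
    have key'' : ∀ i j : Fin n, Linked q i j → R i j := by
      intro i j hl
      rcases lt_trichotomy i j with h | h | h
      · exact key' i j h hl
      · subst h; exact s.iseqv.refl i
      · exact s.iseqv.symm (key' j i h hl.symm)
    intro V hV
    obtain ⟨i, hi⟩ := q.nonempty_of_mem_parts hV
    refine ⟨(Finpartition.ofSetoid s).part i, Finpartition.part_mem _ |>.2 (mem_univ i), ?_⟩
    intro j hj
    rw [← linked_iff_mem_part, hs]
    exact key'' i j ⟨V, hV, hi, hj⟩

theorem UnionNonCrossing.right {n : ℕ} {p q : Finpartition (univ : Finset (Fin n))}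
    (h : UnionNonCrossing p q) : NonCrossingRel (fun x : Fin n => (x : ℕ)) (Linked q) := by
  intro a b c d hab hbc hcd hac hbd
  have := h (Sum.inr a) (Sum.inr b) (Sum.inr c) (Sum.inr d)
    (by simp [interleave] at *; omega) (by simp [interleave] at *; omega)
    (by simp [interleave] at *; omega) (Sum.LiftRel.inr hac) (Sum.LiftRel.inr hbd)
  simpa using this

/-- The Kreweras complement `Kr(p)` of `p ∈ NC(n)`: the biggest partition of `[n̄] ≃ [n]`, for the
order in which `q ≤ q'` if every block of `q` is contained in a block of `q'`, such that `p ∪ Kr(p)`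
is a non-crossing partition of `[n] ∪ [n̄]`. -/
noncomputable def kreweras {n : ℕ} (p : NC n) : NC n :=
  ⟨(exists_isGreatest_unionNonCrossing p).choose,
    UnionNonCrossing.right (exists_isGreatest_unionNonCrossing p).choose_spec.1⟩

theorem kreweras_isGreatest {n : ℕ} (p : NC n) :
    IsGreatest {q | UnionNonCrossing p.1 q} (kreweras p).1 :=
  (exists_isGreatest_unionNonCrossing p).choose_spec

/-! ### `𝒞_k`-non-crossing cumulants -/

section Cumulants

variable {k : ℕ} {A : Type*} [Ring A] [Algebra ℂ A]

/-- `(a_1, …, a_n) | V = (a_{v_1}, …, a_{v_m})` for `V = {v_1 < ⋯ < v_m}`. -/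
def restrictTuple {B : Type*} {n : ℕ} (a : Fin n → B) (V : Finset (Fin n)) : Fin V.card → B :=
  fun j => a (V.orderEmbOfFin rfl j)

theorem restrictTuple_update_of_mem {B : Type*} {n : ℕ} (a : Fin n → B) (V : Finset (Fin n))
    {i : Fin n} (hi : i ∈ V) :
    ∃ j, ∀ x, restrictTuple (Function.update a i x) V = Function.update (restrictTuple a V) j x := by
  obtain ⟨j, hj⟩ : i ∈ Set.range (V.orderEmbOfFin rfl) := by
    rw [Finset.range_orderEmbOfFin]; exact hi
  refine ⟨j, fun x => funext fun l => ?_⟩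
  subst hj
  by_cases h : l = j
  · subst h; simp [restrictTuple]
  · have h' : V.orderEmbOfFin rfl l ≠ V.orderEmbOfFin rfl j := fun e =>
      h ((V.orderEmbOfFin rfl).injective e)
    simp only [restrictTuple, Function.update_of_ne h, Function.update_of_ne h']

theorem restrictTuple_update_of_notMem {B : Type*} {n : ℕ} (a : Fin n → B) (V : Finset (Fin n))
    {i : Fin n} (hi : i ∉ V) (x : B) :
    restrictTuple (Function.update a i x) V = restrictTuple a V := by
  funext l
  have : V.orderEmbOfFin rfl l ≠ i := fun h => hi (h ▸ Finset.orderEmbOfFin_mem V rfl l)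
  simp [restrictTuple, Function.update_of_ne this]

theorem exists_prod_update (r : ∀ n : ℕ, MultilinearMap ℂ (fun _ : Fin n => A) (CAlg k))
    {n : ℕ} (p : Finpartition (univ : Finset (Fin n))) (a : Fin n → A) (i : Fin n) :
    ∃ (m : ℕ) (b : Fin m → A) (j : Fin m) (c : CAlg k), ∀ x,
      ∏ V ∈ p.parts, r V.card (restrictTuple (Function.update a i x) V)
        = r m (Function.update b j x) * c := by
  obtain ⟨W, hW, hiW⟩ := p.exists_mem (mem_univ i)
  obtain ⟨j, hj⟩ := restrictTuple_update_of_mem a W hiW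
  refine ⟨W.card, restrictTuple a W, j, ∏ V ∈ p.parts.erase W, r V.card (restrictTuple a V),
    fun x => ?_⟩
  rw [← Finset.mul_prod_erase _ _ hW, hj]
  congr 1
  refine Finset.prod_congr rfl fun V hV => ?_
  rw [restrictTuple_update_of_notMem]
  intro hiV
  exact (Finset.mem_erase.1 hV).1
    (p.eq_of_mem_parts (Finset.mem_erase.1 hV).2 hW hiV hiW)

/-- `r_π(a_1, …, a_n) = ∏_{V ∈ π} r_{|V|}((a_1, …, a_n) | V)`, for a family `(r_n)` of multilinear
maps. -/
noncomputable def multPart (r : ∀ n : ℕ, MultilinearMap ℂ (fun _ : Fin n => A) (CAlg k))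
    {n : ℕ} (p : NC n) : MultilinearMap ℂ (fun _ : Fin n => A) (CAlg k) :=
  MultilinearMap.mk' (fun a => ∏ V ∈ p.1.parts, r V.card (restrictTuple a V))
    (fun a i x y => by
      obtain ⟨m, b, j, c, h⟩ := exists_prod_update r p.1 a i
      rw [h, h, h, MultilinearMap.map_update_add, add_mul])
    (fun a i c x => by
      obtain ⟨m, b, j, d, h⟩ := exists_prod_update r p.1 a i
      rw [h, h, MultilinearMap.map_update_smul, smul_mul_assoc])

theorem multPart_apply (r : ∀ n : ℕ, MultilinearMap ℂ (fun _ : Fin n => A) (CAlg k))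
    {n : ℕ} (p : NC n) (a : Fin n → A) :
    multPart r p a = ∏ V ∈ p.1.parts, r V.card (restrictTuple a V) := rfl

/-- The moment functional `(a_1, …, a_n) ↦ φ(a_1 ⋯ a_n)`. -/
noncomputable def moment (φ : A →ₗ[ℂ] CAlg k) (n : ℕ) :
    MultilinearMap ℂ (fun _ : Fin n => A) (CAlg k) :=
  φ.compMultilinearMap (MultilinearMap.mkPiAlgebraFin ℂ n A)

theorem moment_apply (φ : A →ₗ[ℂ] CAlg k) (n : ℕ) (a : Fin n → A) :
    moment φ n a = φ (List.ofFn a).prod := by simp [moment]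

/-- The `𝒞_k`-non-crossing cumulant functionals `κ_n`, obtained by solving the free moment-cumulant
formula `∑_{p ∈ NC(n)} κ_p(a_1, …, a_n) = φ(a_1 ⋯ a_n)` recursively for the term of the one-block
partition; all the other partitions only involve `κ_m` with `m < n`. That the formula holds and
determines `κ_n`, `n ≥ 1`, is shown in `sum_multPart_cumulant` and `eq_cumulant`. -/
noncomputable def cumulant (φ : A →ₗ[ℂ] CAlg k) :
    (n : ℕ) → MultilinearMap ℂ (fun _ : Fin n => A) (CAlg k) :=
  fun n => Nat.strongRec (motive := fun n => MultilinearMap ℂ (fun _ : Fin n => A) (CAlg k))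
    (fun n ih => by
      classical
      exact moment φ n - ∑ p : NC n with univ ∉ p.1.parts,
        multPart (fun m => if h : m < n then ih m h else 0) p) n

theorem card_lt_of_univ_notMem {n : ℕ} {p : NC n} (hp : univ ∉ p.1.parts) {V : Finset (Fin n)}
    (hV : V ∈ p.1.parts) : V.card < n := by
  have hne : V ≠ univ := fun h => hp (h ▸ hV)
  simpa using Finset.card_lt_card (Finset.ssubset_univ_iff.2 hne)

open Classical in
theorem cumulant_eq (φ : A →ₗ[ℂ] CAlg k) (n : ℕ) :
    cumulant φ n = moment φ n - ∑ p : NC n with univ ∉ p.1.parts, multPart (cumulant φ) p := by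
  have h : cumulant φ n = moment φ n - ∑ p : NC n with univ ∉ p.1.parts,
      multPart (fun m => if h : m < n then cumulant φ m else 0) p := by
    unfold cumulant
    conv_lhs => rw [Nat.strongRec]
  rw [h]
  congr 1
  refine Finset.sum_congr rfl fun p hp => ?_
  ext1 a
  rw [multPart_apply, multPart_apply]
  refine Finset.prod_congr rfl fun V hV => ?_
  rw [dif_pos (card_lt_of_univ_notMem (Finset.mem_filter.1 hp).2 hV)]

/-- The partition `1_n` with the single block `[n]`. -/
def NC.one (n : ℕ) (hn : 1 ≤ n) : NC n :=
  ⟨Finpartition.indiscrete (a := (univ : Finset (Fin n)))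
      (Finset.univ_nonempty_iff.2 ⟨⟨0, hn⟩⟩).ne_empty,
    fun a b _ _ _ _ _ _ _ => ⟨univ, by simp, mem_univ a, mem_univ b⟩⟩

theorem NC.eq_one_iff {n : ℕ} (hn : 1 ≤ n) (p : NC n) : univ ∈ p.1.parts ↔ p = NC.one n hn := by
  constructor
  · intro h
    apply Subtype.ext
    apply Finpartition.ext
    change p.1.parts = {univ}
    refine Finset.eq_singleton_iff_unique_mem.2 ⟨h, fun V hV => ?_⟩
    obtain ⟨i, hi⟩ := p.1.nonempty_of_mem_parts hV
    exact p.1.eq_of_mem_parts hV h hi (mem_univ i)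
  · rintro rfl; simp [NC.one]

theorem multPart_one (r : ∀ n : ℕ, MultilinearMap ℂ (fun _ : Fin n => A) (CAlg k))
    (n : ℕ) (hn : 1 ≤ n) : multPart r (NC.one n hn) = r n := by
  ext a : 1
  have h : ∀ (m : ℕ) (f : Fin m ↪o Fin n), m = n → r m (fun j => a (f j)) = r n a := by
    rintro m f rfl
    congr 1
    funext j
    have hf : StrictMono f := f.strictMono
    congr 1
    exact congrFun (StrictMono.eq_id hf) j
  rw [multPart_apply]
  change ∏ V ∈ {univ}, r V.card (restrictTuple a V) = _
  rw [Finset.prod_singleton]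
  exact h _ (Finset.orderEmbOfFin univ rfl) (by simp)

open Classical in
theorem sum_multPart_eq (r : ∀ n : ℕ, MultilinearMap ℂ (fun _ : Fin n => A) (CAlg k))
    (n : ℕ) (hn : 1 ≤ n) :
    ∑ p : NC n, multPart r p = r n + ∑ p : NC n with univ ∉ p.1.parts, multPart r p := by
  rw [← Finset.sum_filter_add_sum_filter_not univ (fun p : NC n => univ ∈ p.1.parts)]
  congr 1
  have : (univ.filter fun p : NC n => univ ∈ p.1.parts) = {NC.one n hn} := by
    ext p; simp [NC.eq_one_iff hn]
  rw [this, Finset.sum_singleton, multPart_one]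

/-- The free moment-cumulant formula. -/
theorem sum_multPart_cumulant (φ : A →ₗ[ℂ] CAlg k) (n : ℕ) (hn : 1 ≤ n) (a : Fin n → A) :
    ∑ p : NC n, multPart (cumulant φ) p a = φ (List.ofFn a).prod := by
  classical
  have h := sum_multPart_eq (cumulant φ) n hn
  rw [cumulant_eq φ n, sub_add_cancel] at h
  rw [← moment_apply, ← h, _root_.sum_apply]

/-- The free moment-cumulant formula determines the cumulants. -/
theorem eq_cumulant (φ : A →ₗ[ℂ] CAlg k)
    (r : ∀ n : ℕ, MultilinearMap ℂ (fun _ : Fin n => A) (CAlg k))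
    (hr : ∀ n, 1 ≤ n → ∀ a : Fin n → A, ∑ p : NC n, multPart r p a = φ (List.ofFn a).prod)
    (n : ℕ) (hn : 1 ≤ n) : r n = cumulant φ n := by
  classical
  induction n using Nat.strong_induction_on with
  | _ n ih =>
    have h1 : ∑ p : NC n, multPart r p = moment φ n := by
      ext1 a; rw [_root_.sum_apply, hr n hn, moment_apply]
    rw [cumulant_eq, ← h1, sum_multPart_eq r n hn]
    rw [eq_sub_iff_add_eq]
    congr 1
    refine Finset.sum_congr rfl fun p hp => ?_
    ext1 a
    rw [multPart_apply, multPart_apply]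
    refine Finset.prod_congr rfl fun V hV => ?_
    rw [ih V.card (card_lt_of_univ_notMem (Finset.mem_filter.1 hp).2 hV)
      (Finset.card_pos.2 (p.1.nonempty_of_mem_parts hV))]

/-- Subsets `M_1, …, M_l` of `A` are infinitesimally free of order `k` if their mixed
`𝒞_k`-cumulants vanish. -/
def InfinitesimallyFree (φ : A →ₗ[ℂ] CAlg k) {l : ℕ} (M : Fin l → Set A) : Prop :=
  ∀ (m : ℕ) (i : Fin m → Fin l) (a : Fin m → A), (∀ s, a s ∈ M (i s)) →
    (∃ s t : Fin m, s < t ∧ i s ≠ i t) → cumulant φ m a = 0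

end Cumulants

/-! Place $a_i$ at position $2i$ and $b_i$ at position $2i+1$ of a single sequence $x$. The argument
has three ingredients.

Cumulants with products as entries (`cumulantOn_mul`): the cumulant of the products
$x_{2i}x_{2i+1}$, $i\in S$, is the sum of $\prod_{B\in C}\tilde\kappa(x|_B)$ over the non-crossing
partitions $C$ of the doubled set whose join with the pairing $\{2i,2i+1\}$ has one block. Indeed,
expand the moment of the doubled sequence over all non-crossing $C$ and group the terms by the join.
The join is again non-crossing (`eq_of_crossing`), and the partitions with join $\pi$ are the
independent choices of a connected partition over each block of $\pi$ (`sum_prod_joinPartition_eq`).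
Hence the candidate expression satisfies the moment-cumulant relation for the products, and this
relation has only one solution (`eq_of_sum_ncPartitions_eq`).

Freeness: a block containing both an even and an odd position contributes a mixed cumulant, which
vanishes. Only the partitions $C=p\cup q$ survive, with $p$ on the even and $q$ on the odd
positions.

Kreweras complement: for $p\cup q$ non-crossing, the join with the pairing has one block exactly
when $q=\mathrm{Kr}(p)$ (`jointlyConnected_kreweras`, `eq_kreweras_of_jointlyConnected`). The
surviving terms are therefore indexed by $p\in NC(n)$ alone.

Finite sets of integers replace $[n]$ as index sets, so that restricting to a block and doubling
need no relabelling. -/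

/-! ### Non-crossing partitions of finite sets of natural numbers -/

/-- `C` is the set of blocks of a non-crossing partition of the finite set `S` of integers. -/
structure IsNCPartition (S : Finset ℕ) (C : Finset (Finset ℕ)) : Prop where
  nonempty : ∀ B ∈ C, B.Nonempty
  subset : ∀ B ∈ C, B ⊆ S
  cover : ∀ x ∈ S, ∃ B ∈ C, x ∈ B
  disj : ∀ B ∈ C, ∀ B' ∈ C, ∀ x, x ∈ B → x ∈ B' → B = B'
  nc : ∀ B ∈ C, ∀ B' ∈ C, ∀ a b c d, a < b → b < c → c < d →
    a ∈ B → c ∈ B → b ∈ B' → d ∈ B' → B = B'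

/-- The set of non-crossing partitions of `S`. -/
noncomputable def ncPartitions (S : Finset ℕ) : Finset (Finset (Finset ℕ)) :=
  by classical exact S.powerset.powerset.filter fun C => IsNCPartition S C

theorem mem_ncPartitions {S : Finset ℕ} {C : Finset (Finset ℕ)} :
    C ∈ ncPartitions S ↔ IsNCPartition S C := by
  classical
  unfold ncPartitions
  rw [mem_filter, mem_powerset]
  exact ⟨fun h => h.2, fun h => ⟨fun B hB => mem_powerset.2 (h.subset B hB), h⟩⟩

/-! ### Doubled sets and the join with the pairing $\{2i,2i+1\}$ -/

/-- The doubling `{2i, 2i + 1 | i ∈ S}` of `S`. -/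
def dbl (S : Finset ℕ) : Finset ℕ := S.image (fun i => 2 * i) ∪ S.image (fun i => 2 * i + 1)

theorem mem_dbl {S : Finset ℕ} {x : ℕ} : x ∈ dbl S ↔ x / 2 ∈ S := by
  simp only [dbl, mem_union, mem_image]
  constructor
  · rintro (⟨i, hi, rfl⟩ | ⟨i, hi, rfl⟩)
    · rwa [show 2 * i / 2 = i by omega]
    · rwa [show (2 * i + 1) / 2 = i by omega]
  · intro h
    rcases Nat.even_or_odd' x with ⟨c, rfl | rfl⟩
    · exact Or.inl ⟨_, h, by omega⟩
    · exact Or.inr ⟨_, h, by omega⟩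

/-- `T` is a union of blocks of the partition obtained from `C` by identifying `2i` and `2i + 1`. -/
def Saturated (C : Finset (Finset ℕ)) (T : Finset ℕ) : Prop :=
  ∀ B ∈ C, ∀ x ∈ B, ∀ y ∈ B, x / 2 ∈ T → y / 2 ∈ T

/-- The partition `C` of `dbl S` becomes the one-block partition of `S` once `2i` and `2i + 1` are
identified. -/
def Connects (C : Finset (Finset ℕ)) (S : Finset ℕ) : Prop :=
  ∀ T ⊆ S, Saturated C T → T.Nonempty → T = S

/-- The non-crossing partitions of `dbl S` whose join with `{{2i, 2i + 1} | i ∈ S}` is the one-block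
partition. -/
noncomputable def connectedPartitions (S : Finset ℕ) : Finset (Finset (Finset ℕ)) :=
  by classical exact (ncPartitions (dbl S)).filter fun C => Connects C S

theorem mem_connectedPartitions {S : Finset ℕ} {C : Finset (Finset ℕ)} :
    C ∈ connectedPartitions S ↔ IsNCPartition (dbl S) C ∧ Connects C S := by
  classical
  rw [connectedPartitions, mem_filter, mem_ncPartitions]

/-- The saturation condition is symmetric in the two points of a block, so it passes to complements.
This is what makes the smallest saturated sets pairwise equal or disjoint. -/
theorem Saturated.sdiff {S : Finset ℕ} {C : Finset (Finset ℕ)} (hC : IsNCPartition (dbl S) C)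
    {T : Finset ℕ} (h : Saturated C T) : Saturated C (S \ T) := by
  intro B hB x hx y hy hxT
  rw [mem_sdiff] at hxT ⊢
  exact ⟨mem_dbl.1 (hC.subset B hB hy), fun hyT => hxT.2 (h B hB y hy x hx hyT)⟩

/-- The smallest saturated subset of `S` containing `s`. -/
noncomputable def saturation (S : Finset ℕ) (C : Finset (Finset ℕ)) (s : ℕ) : Finset ℕ :=
  by classical exact S.filter fun t => ∀ T ⊆ S, Saturated C T → s ∈ T → t ∈ T

theorem mem_saturation {S : Finset ℕ} {C : Finset (Finset ℕ)} {s t : ℕ} :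
    t ∈ saturation S C s ↔ t ∈ S ∧ ∀ T ⊆ S, Saturated C T → s ∈ T → t ∈ T := by
  classical
  rw [saturation, mem_filter]

theorem saturation_subset {S : Finset ℕ} {C : Finset (Finset ℕ)} {s : ℕ} :
    saturation S C s ⊆ S := fun _ h => (mem_saturation.1 h).1

theorem mem_saturation_self {S : Finset ℕ} {C : Finset (Finset ℕ)} {s : ℕ} (hs : s ∈ S) :
    s ∈ saturation S C s := mem_saturation.2 ⟨hs, fun _ _ _ h => h⟩

theorem saturated_saturation {S : Finset ℕ} {C : Finset (Finset ℕ)} (hC : IsNCPartition (dbl S) C)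
    (s : ℕ) : Saturated C (saturation S C s) := by
  intro B hB x hx y hy h
  rw [mem_saturation] at h ⊢
  exact ⟨mem_dbl.1 (hC.subset B hB hy), fun T hT hc hs => hc B hB x hx y hy (h.2 T hT hc hs)⟩

theorem saturation_eq_of_mem {S : Finset ℕ} {C : Finset (Finset ℕ)} (hC : IsNCPartition (dbl S) C)
    {s t : ℕ} (hs : s ∈ S) (ht : t ∈ saturation S C s) : saturation S C t = saturation S C s := by
  have ht' := mem_saturation.1 ht
  ext u
  rw [mem_saturation, mem_saturation]
  refine and_congr_right fun hu => ⟨fun h T hT hc hsT => h T hT hc (ht'.2 T hT hc hsT),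
    fun h T hT hc htT => ?_⟩
  refine h T hT hc ?_
  by_contra hsT
  have := ht'.2 (S \ T) sdiff_subset (hc.sdiff hC) (mem_sdiff.2 ⟨hs, hsT⟩)
  exact (mem_sdiff.1 this).2 htT

theorem connects_saturation {S : Finset ℕ} {C : Finset (Finset ℕ)}
    (hC : IsNCPartition (dbl S) C) {s : ℕ} (hsS : s ∈ S) : Connects C (saturation S C s) := by
  rintro T hT hc ⟨t, ht⟩
  have hs : s ∈ T := by
    by_contra hsT
    have := (mem_saturation.1 (hT ht)).2 (S \ T) sdiff_subset (hc.sdiff hC)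
      (mem_sdiff.2 ⟨hsS, hsT⟩)
    exact (mem_sdiff.1 this).2 ht
  exact hT.antisymm fun u hu =>
    (mem_saturation.1 hu).2 T (hT.trans saturation_subset) hc hs

/-- If no block crossed from $P$ to its negation, the points of $V$ satisfying $P$ would form a
proper nonempty saturated subset, against connectedness. -/
theorem Connects.exists_block {C : Finset (Finset ℕ)} {V : Finset ℕ} (hV : Saturated C V)
    (h : Connects C V) (P : ℕ → Prop) {s t : ℕ} (hs : s ∈ V) (ht : t ∈ V) (hPs : P s)
    (hPt : ¬ P t) : ∃ B ∈ C, ∃ x ∈ B, ∃ y ∈ B, x / 2 ∈ V ∧ y / 2 ∈ V ∧ P (x / 2) ∧ ¬ P (y / 2) := by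
  classical
  by_contra hcon
  have key := h (V.filter P) (filter_subset _ _) (fun B hB x hx y hy hxT => by
    rw [mem_filter] at hxT ⊢
    have hyV := hV B hB x hx y hy hxT.1
    refine ⟨hyV, ?_⟩
    by_contra hPy
    exact hcon ⟨B, hB, x, hx, y, hy, hxT.1, hyV, hxT.2, hPy⟩) ⟨s, mem_filter.2 ⟨hs, hPs⟩⟩
  rw [← key, mem_filter] at ht
  exact hPt ht.2

/-- Suppose that $V$ and $V'$ are disjoint. Connectedness of $V'$ gives a block with a point $u$
over the interval $(a,c)$ and a point $v$ over its complement. Exactly one of $a,c\in V$ then lies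
between $u/2$ and $v/2$, so connectedness of $V$ gives a block with points over both the inside and
the outside of that interval. The two blocks cross, hence coincide, and $V$ and $V'$ meet after all.
-/
theorem eq_of_crossing {S : Finset ℕ} {C : Finset (Finset ℕ)} (hC : IsNCPartition (dbl S) C)
    {V V' : Finset ℕ} (hV : Saturated C V) (hVc : Connects C V) (hV' : Saturated C V')
    (hVc' : Connects C V') {a b c d : ℕ} (hab : a < b) (hbc : b < c) (hcd : c < d)
    (ha : a ∈ V) (hc : c ∈ V) (hb : b ∈ V') (hd : d ∈ V') : (V ∩ V').Nonempty := by
  by_contra hdisj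
  rw [not_nonempty_iff_eq_empty, ← disjoint_iff_inter_eq_empty, disjoint_left] at hdisj
  obtain ⟨B, hB, u, hu, v, hv, huV, hvV, hPu, hPv⟩ :=
    hVc'.exists_block hV' (fun t => a < t ∧ t < c) hb hd ⟨hab, hbc⟩ (by omega)
  have hva : v / 2 ≠ a := fun h => hdisj ha (h ▸ hvV)
  have hvc : v / 2 ≠ c := fun h => hdisj hc (h ▸ hvV)
  have hne : ∀ x, x / 2 ∈ V → x / 2 ≠ u / 2 ∧ x / 2 ≠ v / 2 := fun x hx =>
    ⟨fun h => hdisj hx (h ▸ huV), fun h => hdisj hx (h ▸ hvV)⟩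
  obtain ⟨B', hB', x, hx, y, hy, hxV, hyV, hPx, hPy⟩ : ∃ B' ∈ C, ∃ x ∈ B', ∃ y ∈ B',
      x / 2 ∈ V ∧ y / 2 ∈ V ∧
      (u / 2 < x / 2 ∧ x / 2 < v / 2 ∨ v / 2 < x / 2 ∧ x / 2 < u / 2) ∧
      ¬ (u / 2 < y / 2 ∧ y / 2 < v / 2 ∨ v / 2 < y / 2 ∧ y / 2 < u / 2) := by
    rcases lt_or_gt_of_ne hva with h | h
    · exact hVc.exists_block hV
        (fun t => u / 2 < t ∧ t < v / 2 ∨ v / 2 < t ∧ t < u / 2) ha hc (by omega) (by omega)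
    · exact hVc.exists_block hV
        (fun t => u / 2 < t ∧ t < v / 2 ∨ v / 2 < t ∧ t < u / 2) hc ha (by omega) (by omega)
  have h1 := hne x hxV
  have h2 := hne y hyV
  -- The four halves involved are distinct where they are compared, so their order is also the order
  -- of the points of `dbl S` above them.
  have hBB : B = B' := by
    rcases lt_or_gt_of_ne (show u / 2 ≠ v / 2 by omega) with huv | huv <;>
    rcases lt_or_gt_of_ne (show x / 2 ≠ y / 2 by omega) with hxy | hxy
    · exact hC.nc B hB B' hB' u x v y (by omega) (by omega) (by omega) hu hv hx hy
    · exact (hC.nc B' hB' B hB y u x v (by omega) (by omega) (by omega) hy hx hu hv).symm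
    · exact hC.nc B hB B' hB' v x u y (by omega) (by omega) (by omega) hv hu hx hy
    · exact (hC.nc B' hB' B hB y v x u (by omega) (by omega) (by omega) hy hx hv hu).symm
  subst hBB
  exact hdisj (hV B hB x hx u hu hxV) huV

/-- The join of the partition `C` of `dbl S` with `{{2i, 2i + 1} | i ∈ S}`, as a partition of
`S`. -/
noncomputable def joinPartition (S : Finset ℕ) (C : Finset (Finset ℕ)) : Finset (Finset ℕ) :=
  S.image (saturation S C)

theorem mem_joinPartition {S : Finset ℕ} {C : Finset (Finset ℕ)} {V : Finset ℕ} :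
    V ∈ joinPartition S C ↔ ∃ s ∈ S, saturation S C s = V := by
  rw [joinPartition, mem_image]

theorem isNCPartition_joinPartition {S : Finset ℕ} {C : Finset (Finset ℕ)}
    (hC : IsNCPartition (dbl S) C) : IsNCPartition S (joinPartition S C) := by
  have hdisj : ∀ B ∈ joinPartition S C, ∀ B' ∈ joinPartition S C, ∀ x, x ∈ B → x ∈ B' →
      B = B' := by
    intro V hV V' hV' x hx hx'
    obtain ⟨s, hs, rfl⟩ := mem_joinPartition.1 hV
    obtain ⟨t, ht, rfl⟩ := mem_joinPartition.1 hV'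
    rw [← saturation_eq_of_mem hC hs hx, ← saturation_eq_of_mem hC ht hx']
  refine ⟨fun V hV => ?_, fun V hV => ?_, fun x hx => ?_, hdisj, ?_⟩
  · obtain ⟨s, hs, rfl⟩ := mem_joinPartition.1 hV
    exact ⟨s, mem_saturation_self hs⟩
  · obtain ⟨s, hs, rfl⟩ := mem_joinPartition.1 hV
    exact saturation_subset
  · exact ⟨_, mem_joinPartition.2 ⟨x, hx, rfl⟩, mem_saturation_self hx⟩
  · intro V hV V' hV' a b c d hab hbc hcd ha hc hb hd
    obtain ⟨s, hs, hsV⟩ := mem_joinPartition.1 hV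
    obtain ⟨t, ht, htV⟩ := mem_joinPartition.1 hV'
    obtain ⟨x, hx⟩ := eq_of_crossing hC (hsV ▸ saturated_saturation hC s)
      (hsV ▸ connects_saturation hC hs) (htV ▸ saturated_saturation hC t)
      (htV ▸ connects_saturation hC ht) hab hbc hcd ha hc hb hd
    exact hdisj V hV V' hV' x (mem_inter.1 hx).1 (mem_inter.1 hx).2

/-- As $V$ is saturated, a block of $C$ meeting `dbl V` lies inside it, so discarding the other
blocks affects neither covering nor connectedness. -/
theorem filter_mem_connectedPartitions {S : Finset ℕ} {C : Finset (Finset ℕ)}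
    (hC : IsNCPartition (dbl S) C) {V : Finset ℕ} (hV : V ∈ joinPartition S C) :
    C.filter (· ⊆ dbl V) ∈ connectedPartitions V := by
  obtain ⟨s, hs, hsV⟩ := mem_joinPartition.1 hV
  have hsat : Saturated C V := hsV ▸ saturated_saturation hC s
  have hcon : Connects C V := hsV ▸ connects_saturation hC hs
  have hVS : V ⊆ S := hsV ▸ saturation_subset
  have hsub : ∀ B ∈ C, ∀ x ∈ B, x / 2 ∈ V → B ⊆ dbl V := fun B hB x hx hxV y hy =>
    mem_dbl.2 (hsat B hB x hx y hy hxV)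
  rw [mem_connectedPartitions]
  refine ⟨⟨fun B hB => hC.nonempty B (mem_filter.1 hB).1, fun B hB => (mem_filter.1 hB).2,
    fun x hx => ?_, fun B hB B' hB' => hC.disj B (mem_filter.1 hB).1 B' (mem_filter.1 hB').1,
    fun B hB B' hB' => hC.nc B (mem_filter.1 hB).1 B' (mem_filter.1 hB').1⟩, ?_⟩
  · obtain ⟨B, hB, hxB⟩ := hC.cover x (mem_dbl.2 (hVS (mem_dbl.1 hx)))
    exact ⟨B, mem_filter.2 ⟨hB, hsub B hB x hxB (mem_dbl.1 hx)⟩, hxB⟩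
  · intro T hT hTc
    refine hcon T hT fun B hB x hx y hy hxT => ?_
    exact hTc B (mem_filter.2 ⟨hB, hsub B hB x hx (hT hxT)⟩) x hx y hy hxT

/-! ### Gluing connected partitions over the blocks of a non-crossing partition -/

section Glue

variable {S : Finset ℕ} {π : Finset (Finset ℕ)} {G : Finset ℕ → Finset (Finset ℕ)}

/-- Halving turns a crossing in `dbl S` into a crossing in $S$, unless two consecutive points among
the four have the same half. In that case the two blocks of $\pi$ share a point and agree anyway. -/
theorem isNCPartition_biUnion (hπ : IsNCPartition S π)
    (hG : ∀ V ∈ π, IsNCPartition (dbl V) (G V)) : IsNCPartition (dbl S) (π.biUnion G) := by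
  have key : ∀ {V B x}, V ∈ π → B ∈ G V → x ∈ B → x / 2 ∈ V := fun hV hB hx =>
    mem_dbl.1 ((hG _ hV).subset _ hB hx)
  refine ⟨?_, ?_, ?_, ?_, ?_⟩
  · intro B hB
    obtain ⟨V, hV, hB⟩ := mem_biUnion.1 hB
    exact (hG V hV).nonempty B hB
  · intro B hB x hx
    obtain ⟨V, hV, hB⟩ := mem_biUnion.1 hB
    exact mem_dbl.2 (hπ.subset V hV (key hV hB hx))
  · intro x hx
    obtain ⟨V, hV, hxV⟩ := hπ.cover _ (mem_dbl.1 hx)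
    obtain ⟨B, hB, hxB⟩ := (hG V hV).cover x (mem_dbl.2 hxV)
    exact ⟨B, mem_biUnion.2 ⟨V, hV, hB⟩, hxB⟩
  · intro B hB B' hB' x hx hx'
    obtain ⟨V, hV, hB⟩ := mem_biUnion.1 hB
    obtain ⟨V', hV', hB'⟩ := mem_biUnion.1 hB'
    obtain rfl := hπ.disj V hV V' hV' _ (key hV hB hx) (key hV' hB' hx')
    exact (hG V hV).disj B hB B' hB' x hx hx'
  · intro B hB B' hB' a b c d hab hbc hcd ha hc hb hd
    obtain ⟨V, hV, hB⟩ := mem_biUnion.1 hB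
    obtain ⟨V', hV', hB'⟩ := mem_biUnion.1 hB'
    have hVV : V = V' := by
      have ha' := key hV hB ha
      have hc' := key hV hB hc
      have hb' := key hV' hB' hb
      have hd' := key hV' hB' hd
      by_cases h1 : a / 2 = b / 2
      · exact hπ.disj V hV V' hV' _ ha' (h1 ▸ hb')
      by_cases h2 : b / 2 = c / 2
      · exact hπ.disj V hV V' hV' _ hc' (h2 ▸ hb')
      by_cases h3 : c / 2 = d / 2
      · exact hπ.disj V hV V' hV' _ hc' (h3 ▸ hd')
      exact hπ.nc V hV V' hV' _ _ _ _ (by omega) (by omega) (by omega) ha' hc' hb' hd'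
    subst hVV
    exact (hG V hV).nc B hB B' hB' a b c d hab hbc hcd ha hc hb hd

theorem filter_biUnion_eq (hπ : IsNCPartition S π)
    (hG : ∀ V ∈ π, IsNCPartition (dbl V) (G V)) {V : Finset ℕ} (hV : V ∈ π) :
    (π.biUnion G).filter (· ⊆ dbl V) = G V := by
  ext B
  rw [mem_filter, mem_biUnion]
  constructor
  · rintro ⟨⟨V', hV', hB⟩, hsub⟩
    obtain ⟨x, hx⟩ := (hG V' hV').nonempty B hB
    obtain rfl := hπ.disj V hV V' hV' _ (mem_dbl.1 (hsub hx))
      (mem_dbl.1 ((hG V' hV').subset B hB hx))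
    exact hB
  · exact fun hB => ⟨⟨V, hV, hB⟩, (hG V hV).subset B hB⟩

/-- Each $V\in\pi$ is saturated for the glued partition, so the saturation of a point of $V$ stays
in $V$. That saturation is also saturated for `G V` alone, and connectedness of `G V` makes it all
of $V$. -/
theorem joinPartition_biUnion (hπ : IsNCPartition S π)
    (hG : ∀ V ∈ π, G V ∈ connectedPartitions V) : joinPartition S (π.biUnion G) = π := by
  have hG' : ∀ V ∈ π, IsNCPartition (dbl V) (G V) := fun V hV =>
    (mem_connectedPartitions.1 (hG V hV)).1
  have hC := isNCPartition_biUnion hπ hG'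
  have hsat : ∀ V ∈ π, Saturated (π.biUnion G) V := by
    intro V hV B hB x hx y hy hxV
    obtain ⟨V', hV', hB⟩ := mem_biUnion.1 hB
    obtain rfl := hπ.disj V hV V' hV' _ hxV (mem_dbl.1 ((hG' V' hV').subset B hB hx))
    exact mem_dbl.1 ((hG' V hV).subset B hB hy)
  have key : ∀ V ∈ π, ∀ s ∈ V, saturation S (π.biUnion G) s = V := by
    intro V hV s hs
    have hsS := hπ.subset V hV hs
    have hle : saturation S (π.biUnion G) s ⊆ V := fun t ht =>
      (mem_saturation.1 ht).2 V (hπ.subset V hV) (hsat V hV) hs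
    refine (mem_connectedPartitions.1 (hG V hV)).2 _ hle ?_ ⟨s, mem_saturation_self hsS⟩
    exact fun B hB => saturated_saturation hC s B (mem_biUnion.2 ⟨V, hV, hB⟩)
  ext V
  rw [mem_joinPartition]
  constructor
  · rintro ⟨s, hs, rfl⟩
    obtain ⟨V, hV, hsV⟩ := hπ.cover s hs
    rwa [key V hV s hsV]
  · intro hV
    obtain ⟨s, hs⟩ := hπ.nonempty V hV
    exact ⟨s, hπ.subset V hV hs, key V hV s hs⟩

theorem biUnion_filter_joinPartition {C : Finset (Finset ℕ)} (hC : IsNCPartition (dbl S) C) :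
    (joinPartition S C).biUnion (fun V => C.filter (· ⊆ dbl V)) = C := by
  ext B
  rw [mem_biUnion]
  constructor
  · rintro ⟨V, hV, hB⟩
    exact (mem_filter.1 hB).1
  · intro hB
    obtain ⟨x, hx⟩ := hC.nonempty B hB
    have hxS := mem_dbl.1 (hC.subset B hB hx)
    refine ⟨_, mem_joinPartition.2 ⟨_, hxS, rfl⟩, mem_filter.2 ⟨hB, fun y hy => mem_dbl.2 ?_⟩⟩
    exact saturated_saturation hC _ B hB x hx y hy (mem_saturation_self hxS)

end Glue

/-- The non-crossing partitions of `dbl S` with a given join are families of connected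
partitions. -/
theorem sum_prod_joinPartition_eq {R : Type*} [CommRing R] (w : Finset ℕ → R) {S : Finset ℕ}
    {π : Finset (Finset ℕ)} (hπ : IsNCPartition S π) :
    ∑ C ∈ ncPartitions (dbl S) with joinPartition S C = π, ∏ B ∈ C, w B
      = ∏ V ∈ π, ∑ C ∈ connectedPartitions V, ∏ B ∈ C, w B := by
  classical
  rw [Finset.prod_sum]
  symm
  -- Expanding the product of sums gives choice functions defined only on blocks of $\pi$. The empty
  -- value elsewhere makes them total, as `biUnion` requires, and is never used.
  let ext : (∀ V ∈ π, Finset (Finset ℕ)) → Finset ℕ → Finset (Finset ℕ) :=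
    fun g V => if h : V ∈ π then g V h else ∅
  have hext : ∀ (g : ∀ V ∈ π, Finset (Finset ℕ)) V (h : V ∈ π), ext g V = g V h :=
    fun g V h => dif_pos h
  have hmem : ∀ g ∈ π.pi connectedPartitions, ∀ V ∈ π, ext g V ∈ connectedPartitions V :=
    fun g hg V hV => by rw [hext g V hV]; exact mem_pi.1 hg V hV
  have hmem' : ∀ g ∈ π.pi connectedPartitions, ∀ V ∈ π, IsNCPartition (dbl V) (ext g V) :=
    fun g hg V hV => (mem_connectedPartitions.1 (hmem g hg V hV)).1
  refine Finset.sum_nbij' (fun g => π.biUnion (ext g)) (fun C V _ => C.filter (· ⊆ dbl V))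
    ?_ ?_ ?_ ?_ ?_
  · intro g hg
    exact mem_filter.2 ⟨mem_ncPartitions.2 (isNCPartition_biUnion hπ (hmem' g hg)),
      joinPartition_biUnion hπ (hmem g hg)⟩
  · intro C hC
    obtain ⟨hC', hj⟩ := mem_filter.1 hC
    subst hj
    exact mem_pi.2 fun V hV => filter_mem_connectedPartitions (mem_ncPartitions.1 hC') hV
  · intro g hg
    funext V hV
    rw [filter_biUnion_eq hπ (hmem' g hg) hV, hext]
  · intro C hC
    obtain ⟨hC', hj⟩ := mem_filter.1 hC
    subst hj
    refine Eq.trans ?_ (biUnion_filter_joinPartition (mem_ncPartitions.1 hC'))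
    exact Finset.biUnion_congr rfl fun V hV =>
      hext (fun V _ => C.filter (· ⊆ dbl V)) V hV
  · intro g hg
    rw [Finset.prod_biUnion, ← Finset.prod_attach π fun V => ∏ B ∈ ext g V, w B]
    · exact Finset.prod_congr rfl fun V _ => by rw [hext g V.1 V.2]
    · intro V hV V' hV' hne
      refine disjoint_left.2 fun B hB hB' => hne ?_
      obtain ⟨x, hx⟩ := (hmem' g hg V hV).nonempty B hB
      exact hπ.disj V hV V' hV' _ (mem_dbl.1 ((hmem' g hg V hV).subset B hB hx))
        (mem_dbl.1 ((hmem' g hg V' hV').subset B hB' hx))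

theorem sum_ncPartitions_dbl {R : Type*} [CommRing R] (w : Finset ℕ → R) (S : Finset ℕ) :
    ∑ C ∈ ncPartitions (dbl S), ∏ B ∈ C, w B
      = ∑ π ∈ ncPartitions S, ∏ V ∈ π, ∑ C ∈ connectedPartitions V, ∏ B ∈ C, w B := by
  classical
  rw [← Finset.sum_fiberwise_of_maps_to (g := joinPartition S) (t := ncPartitions S) fun C hC =>
    mem_ncPartitions.2 (isNCPartition_joinPartition (mem_ncPartitions.1 hC))]
  exact Finset.sum_congr rfl fun π hπ => sum_prod_joinPartition_eq w (mem_ncPartitions.1 hπ)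

/-! ### Uniqueness of the solution of the moment-cumulant relation -/

theorem isNCPartition_singleton {S : Finset ℕ} (hS : S.Nonempty) : IsNCPartition S {S} := by
  refine ⟨?_, ?_, fun x hx => ⟨S, mem_singleton_self S, hx⟩, ?_, ?_⟩
  · simpa using hS
  · simp
  · simp +contextual
  · simp +contextual

/-- A function on nonempty finite sets is determined by its sums over non-crossing partitions. -/
theorem eq_of_sum_ncPartitions_eq {R : Type*} [CommRing R] {g h : Finset ℕ → R}
    (H : ∀ S : Finset ℕ, S.Nonempty →
      ∑ π ∈ ncPartitions S, ∏ V ∈ π, g V = ∑ π ∈ ncPartitions S, ∏ V ∈ π, h V)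
    (S : Finset ℕ) (hS : S.Nonempty) : g S = h S := by
  classical
  induction S using Finset.strongInduction with
  | H S ih =>
    -- The one-block partition contributes the value at $S$ itself. Every other partition has only
    -- proper subsets of $S$ as blocks, where the induction hypothesis applies.
    have hone : {S} ∈ ncPartitions S := mem_ncPartitions.2 (isNCPartition_singleton hS)
    have key := H S hS
    rw [← Finset.add_sum_erase _ _ hone, ← Finset.add_sum_erase _ _ hone, prod_singleton,
      prod_singleton] at key
    have hrest : ∑ π ∈ (ncPartitions S).erase {S}, ∏ V ∈ π, g V
        = ∑ π ∈ (ncPartitions S).erase {S}, ∏ V ∈ π, h V := by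
      refine Finset.sum_congr rfl fun π hπ => Finset.prod_congr rfl fun V hV => ?_
      obtain ⟨hne, hπ⟩ := mem_erase.1 hπ
      have hπ := mem_ncPartitions.1 hπ
      refine ih V (Finset.ssubset_iff_subset_ne.2 ⟨hπ.subset V hV, ?_⟩) (hπ.nonempty V hV)
      rintro rfl
      refine hne (Finset.eq_singleton_iff_unique_mem.2 ⟨hV, fun V' hV' => ?_⟩)
      obtain ⟨x, hx⟩ := hπ.nonempty V' hV'
      exact hπ.disj V' hV' V hV x hx (hπ.subset V' hV' hx)
    rw [hrest] at key
    exact add_right_cancel key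

/-! ### Comparison with `NC n` -/

theorem NC.eq_of_mem {n : ℕ} (p : NC n) {V V' : Finset (Fin n)} (hV : V ∈ p.1.parts)
    (hV' : V' ∈ p.1.parts) {x : Fin n} (hx : x ∈ V) (hx' : x ∈ V') : V = V' :=
  p.1.eq_of_mem_parts hV hV' hx hx'

theorem NC.eq_of_crossing {n : ℕ} (p : NC n) {V V' : Finset (Fin n)} (hV : V ∈ p.1.parts)
    (hV' : V' ∈ p.1.parts) {a b c d : Fin n} (hab : a < b) (hbc : b < c) (hcd : c < d)
    (ha : a ∈ V) (hc : c ∈ V) (hb : b ∈ V') (hd : d ∈ V') : V = V' := by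
  obtain ⟨W, hW, haW, hbW⟩ := p.2 a b c d hab hbc hcd ⟨V, hV, ha, hc⟩ ⟨V', hV', hb, hd⟩
  rw [p.eq_of_mem hV hW ha haW, p.eq_of_mem hV' hW hb hbW]

/-- A finite set of blocks covering `Fin n` disjointly, as a partition. -/
def Finpartition.ofBlocks {n : ℕ} (P : Finset (Finset (Fin n))) (hne : ∀ V ∈ P, V.Nonempty)
    (hcover : ∀ x, ∃ V ∈ P, x ∈ V) (hdisj : ∀ V ∈ P, ∀ V' ∈ P, ∀ x, x ∈ V → x ∈ V' → V = V') :
    Finpartition (univ : Finset (Fin n)) where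
  parts := P
  supIndep := by
    rw [Finset.supIndep_iff_pairwiseDisjoint]
    intro V hV V' hV' h
    exact disjoint_left.2 fun x hx hx' => h (hdisj V hV V' hV' x hx hx')
  sup_parts := by
    ext x
    obtain ⟨V, hV, hx⟩ := hcover x
    simp only [mem_univ, iff_true, Finset.mem_sup]
    exact ⟨V, hV, hx⟩
  bot_notMem := fun h => by simpa using hne _ h

section Transport

variable {m : ℕ} {e : Fin m → ℕ}

/-- The set of blocks of `p` transported along `e`. -/
def blocksImage (e : Fin m → ℕ) (p : Finpartition (univ : Finset (Fin m))) : Finset (Finset ℕ) :=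
  p.parts.image fun V => V.image e

theorem mem_blocksImage {p : Finpartition (univ : Finset (Fin m))} {B : Finset ℕ} :
    B ∈ blocksImage e p ↔ ∃ V ∈ p.parts, V.image e = B := by
  rw [blocksImage, mem_image]

theorem isNCPartition_blocksImage (he : StrictMono e) (p : NC m) :
    IsNCPartition (univ.image e) (blocksImage e p.1) := by
  refine ⟨?_, ?_, ?_, ?_, ?_⟩
  · intro B hB
    obtain ⟨V, hV, rfl⟩ := mem_blocksImage.1 hB
    exact (p.1.nonempty_of_mem_parts hV).image e
  · intro B hB
    obtain ⟨V, hV, rfl⟩ := mem_blocksImage.1 hB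
    exact image_subset_image (subset_univ V)
  · intro x hx
    obtain ⟨i, -, rfl⟩ := mem_image.1 hx
    obtain ⟨V, hV, hi⟩ := p.1.exists_mem (mem_univ i)
    exact ⟨_, mem_blocksImage.2 ⟨V, hV, rfl⟩, mem_image_of_mem e hi⟩
  · intro B hB B' hB' x hx hx'
    obtain ⟨V, hV, rfl⟩ := mem_blocksImage.1 hB
    obtain ⟨V', hV', rfl⟩ := mem_blocksImage.1 hB'
    obtain ⟨i, hi, rfl⟩ := mem_image.1 hx
    rw [p.eq_of_mem hV hV' hi ((he.injective.mem_finset_image).1 hx')]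
  · intro B hB B' hB' a b c d hab hbc hcd ha hc hb hd
    obtain ⟨V, hV, rfl⟩ := mem_blocksImage.1 hB
    obtain ⟨V', hV', rfl⟩ := mem_blocksImage.1 hB'
    obtain ⟨i, hi, rfl⟩ := mem_image.1 ha
    obtain ⟨j, hj, rfl⟩ := mem_image.1 hb
    obtain ⟨l, hl, rfl⟩ := mem_image.1 hc
    obtain ⟨r, hr, rfl⟩ := mem_image.1 hd
    rw [he.lt_iff_lt] at hab hbc hcd
    rw [p.eq_of_crossing hV hV' hab hbc hcd hi hl hj hr]

theorem blocksImage_injective (he : StrictMono e) :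
    Function.Injective (blocksImage e : Finpartition (univ : Finset (Fin m)) → _) :=
  fun _ _ h => Finpartition.ext (Finset.image_injective (image_injective he.injective) h)

/-- Blocks inside the range of `e` of a non-crossing partition, pulled back along `e`. -/
theorem exists_NC_of_blocks (he : StrictMono e) {S : Finset ℕ} {C D : Finset (Finset ℕ)}
    (hC : IsNCPartition S C) (hDC : D ⊆ C) (hD : ∀ B ∈ D, B ⊆ univ.image e)
    (hcover : ∀ i, ∃ B ∈ D, e i ∈ B) : ∃ p : NC m, blocksImage e p.1 = D := by
  classical
  have himage : ∀ B ∈ D, (univ.filter fun i => e i ∈ B).image e = B := by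
    intro B hB
    ext x
    simp only [mem_image, mem_filter, mem_univ, true_and]
    constructor
    · rintro ⟨i, hi, rfl⟩; exact hi
    · intro hx
      obtain ⟨i, -, rfl⟩ := mem_image.1 (hD B hB hx)
      exact ⟨i, hx, rfl⟩
  have hmem : ∀ V ∈ D.image (fun B => univ.filter fun i => e i ∈ B),
      ∃ B ∈ D, ∀ i, i ∈ V ↔ e i ∈ B := by
    intro V hV
    obtain ⟨B, hB, rfl⟩ := mem_image.1 hV
    exact ⟨B, hB, fun i => by simp⟩
  have hinj : ∀ V V' : Finset (Fin m), ∀ B B' : Finset ℕ, (∀ i, i ∈ V ↔ e i ∈ B) →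
      (∀ i, i ∈ V' ↔ e i ∈ B') → B = B' → V = V' := by
    rintro V V' B _ h h' rfl
    ext i
    rw [h, h']
  let q := Finpartition.ofBlocks (D.image fun B => univ.filter fun i => e i ∈ B)
    (fun V hV => by
      obtain ⟨B, hB, h⟩ := hmem V hV
      obtain ⟨x, hx⟩ := hC.nonempty B (hDC hB)
      obtain ⟨i, -, rfl⟩ := mem_image.1 (hD B hB hx)
      exact ⟨i, (h i).2 hx⟩)
    (fun i => by
      obtain ⟨B, hB, h⟩ := hcover i
      exact ⟨_, mem_image_of_mem _ hB, by simpa using h⟩)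
    (fun V hV V' hV' x hx hx' => by
      obtain ⟨B, hB, h⟩ := hmem V hV
      obtain ⟨B', hB', h'⟩ := hmem V' hV'
      exact hinj V V' B B' h h' (hC.disj B (hDC hB) B' (hDC hB') _ ((h x).1 hx) ((h' x).1 hx')))
  refine ⟨⟨q, ?_⟩, ?_⟩
  · rintro a b c d hab hbc hcd ⟨V, hV, ha, hc⟩ ⟨V', hV', hb, hd⟩
    refine ⟨V, hV, ha, ?_⟩
    obtain ⟨B, hB, h⟩ := hmem V hV
    obtain ⟨B', hB', h'⟩ := hmem V' hV'
    have hBB := hC.nc B (hDC hB) B' (hDC hB') (e a) (e b) (e c) (e d) (he hab) (he hbc) (he hcd)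
      ((h a).1 ha) ((h c).1 hc) ((h' b).1 hb) ((h' d).1 hd)
    exact (h b).2 (hBB ▸ (h' b).1 hb)
  · change (D.image fun B => univ.filter fun i => e i ∈ B).image (fun V => V.image e) = D
    rw [image_image]
    exact (Finset.image_congr fun B hB => himage B hB).trans image_id

theorem sum_NC_eq_sum_ncPartitions {R : Type*} [CommRing R] (he : StrictMono e)
    (f : Finset ℕ → R) :
    ∑ p : NC m, ∏ V ∈ p.1.parts, f (V.image e)
      = ∑ C ∈ ncPartitions (univ.image e), ∏ B ∈ C, f B := by
  refine Finset.sum_nbij (fun p => blocksImage e p.1) ?_ ?_ ?_ ?_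
  · exact fun p _ => mem_ncPartitions.2 (isNCPartition_blocksImage he p)
  · exact fun p _ q _ h => Subtype.ext (blocksImage_injective he h)
  · intro C hC
    have hC := mem_ncPartitions.1 hC
    obtain ⟨p, hp⟩ := exists_NC_of_blocks he hC subset_rfl hC.subset
      (fun i => hC.cover _ (mem_image_of_mem e (mem_univ i)))
    exact ⟨p, mem_coe.2 (mem_univ p), hp⟩
  · intro p _
    change _ = ∏ B ∈ p.1.parts.image _, f B
    rw [Finset.prod_image fun V _ V' _ h => image_injective he.injective h]

end Transport

/-! ### Cumulants of a sequence restricted to a finite set -/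

/-- Doubling keeps the order, so in an ordered product over `dbl S` the factors at $2i$ and $2i+1$
are adjacent. Since the algebra is not commutative, this is needed to read the moment as one of
products. -/
theorem sort_dbl (S : Finset ℕ) :
    (dbl S).sort = S.sort.flatMap fun i => [2 * i, 2 * i + 1] := by
  have hlt : (S.sort.flatMap fun i => [2 * i, 2 * i + 1]).Pairwise (· < ·) := by
    rw [List.pairwise_flatMap]
    refine ⟨fun i _ => by simp, (S.sortedLT_sort).pairwise.imp fun {i j} hij => ?_⟩
    simp only [List.mem_cons, List.not_mem_nil, or_false]
    rintro a (rfl | rfl) b (rfl | rfl) <;> omega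
  have hset : dbl S = (S.sort.flatMap fun i => [2 * i, 2 * i + 1]).toFinset := by
    ext x
    simp only [dbl, mem_union, mem_image, List.mem_toFinset, List.mem_flatMap, Finset.mem_sort,
      List.mem_cons, List.not_mem_nil, or_false]
    constructor
    · rintro (⟨i, hi, rfl⟩ | ⟨i, hi, rfl⟩)
      · exact ⟨i, hi, Or.inl rfl⟩
      · exact ⟨i, hi, Or.inr rfl⟩
    · rintro ⟨i, hi, rfl | rfl⟩
      · exact Or.inl ⟨i, hi, rfl⟩
      · exact Or.inr ⟨i, hi, rfl⟩
  rw [hset]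
  exact (List.toFinset_sort _ (hlt.imp fun h => h.ne)).2 (hlt.imp fun h => h.le)

theorem prod_sort_dbl {A : Type*} [Monoid A] (x : ℕ → A) (S : Finset ℕ) :
    ((dbl S).sort.map x).prod = (S.sort.map fun i => x (2 * i) * x (2 * i + 1)).prod := by
  rw [sort_dbl]
  induction S.sort with
  | nil => rfl
  | cons i l ih => simp only [List.flatMap_cons, List.map_append, List.prod_append, ih,
      List.map_cons, List.map_nil, List.prod_cons, List.prod_nil, mul_one]

section CumulantOn

variable {k : ℕ} {A : Type*} [Ring A] [Algebra ℂ A] (φ : A →ₗ[ℂ] CAlg k)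

/-- The cumulant of the entries of `x` indexed by `S`. -/
noncomputable def cumulantOn (x : ℕ → A) (S : Finset ℕ) : CAlg k :=
  cumulant φ S.card fun j => x (S.orderEmbOfFin rfl j)

theorem cumulantOn_image {m : ℕ} {e : Fin m → ℕ} (he : StrictMono e) (x : ℕ → A) :
    cumulantOn φ x (univ.image e) = cumulant φ m fun i => x (e i) := by
  -- The length is generalised because the cardinality of the image equals $m$ only propositionally.
  -- Once the lengths are identified, the increasing enumeration of a finite set is unique.
  have key : ∀ (l : ℕ) (f : Fin l → ℕ), StrictMono f → m = l → univ.image f = univ.image e →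
      cumulant φ l (fun i => x (f i)) = cumulant φ m fun i => x (e i) := by
    rintro l f hf rfl h
    have hc : (univ.image e).card = m := by simp [card_image_of_injective _ he.injective]
    have h1 := Finset.orderEmbOfFin_unique hc (fun i => mem_image_of_mem e (mem_univ i)) he
    have h2 := Finset.orderEmbOfFin_unique hc
      (fun i => h ▸ mem_image_of_mem f (mem_univ i)) hf
    rw [h2, ← h1]
  refine key _ _ (Finset.orderEmbOfFin _ rfl).strictMono
    (by simp [card_image_of_injective _ he.injective]) ?_
  exact Finset.image_orderEmbOfFin_univ _ rfl

theorem cumulantOn_image_block {m : ℕ} {e : Fin m → ℕ} (he : StrictMono e) (x : ℕ → A)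
    (V : Finset (Fin m)) :
    cumulantOn φ x (V.image e) = cumulant φ V.card (restrictTuple (fun i => x (e i)) V) := by
  have h := cumulantOn_image φ (he.comp (V.orderEmbOfFin rfl).strictMono) x
  rw [← image_image, Finset.image_orderEmbOfFin_univ] at h
  exact h

theorem sum_ncPartitions_cumulantOn (x : ℕ → A) {S : Finset ℕ} (hS : S.Nonempty) :
    ∑ C ∈ ncPartitions S, ∏ B ∈ C, cumulantOn φ x B = φ (S.sort.map x).prod := by
  have he := (S.orderEmbOfFin rfl).strictMono
  have h1 := sum_NC_eq_sum_ncPartitions he (cumulantOn φ x)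
  rw [Finset.image_orderEmbOfFin_univ] at h1
  rw [← h1, ← Finset.listMap_orderEmbOfFin_finRange S rfl, List.map_map, ← List.ofFn_eq_map]
  refine Eq.trans ?_ (sum_multPart_cumulant φ S.card (card_pos.2 hS) _)
  refine Finset.sum_congr rfl fun p _ => ?_
  rw [multPart_apply]
  exact Finset.prod_congr rfl fun V _ => cumulantOn_image_block φ he x V

/-- Cumulants with products of two elements as entries. -/
theorem cumulantOn_mul (x : ℕ → A) {S : Finset ℕ} (hS : S.Nonempty) :
    cumulantOn φ (fun i => x (2 * i) * x (2 * i + 1)) S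
      = ∑ C ∈ connectedPartitions S, ∏ B ∈ C, cumulantOn φ x B := by
  -- Both sides have the same sums over non-crossing partitions: each sum is the moment of the
  -- doubled sequence, on the right by grouping according to the join.
  refine eq_of_sum_ncPartitions_eq
    (h := fun S => ∑ C ∈ connectedPartitions S, ∏ B ∈ C, cumulantOn φ x B) (fun S hS => ?_) S hS
  have hS' : (dbl S).Nonempty := by
    obtain ⟨i, hi⟩ := hS
    exact ⟨2 * i, mem_dbl.2 (by rwa [show 2 * i / 2 = i by omega])⟩
  rw [← sum_ncPartitions_dbl, sum_ncPartitions_cumulantOn φ _ hS,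
    sum_ncPartitions_cumulantOn φ _ hS', prod_sort_dbl]

end CumulantOn

/-! ### Properties of the Kreweras complement -/

section Kreweras

variable {n : ℕ}

theorem Linked.refl (p : Finpartition (univ : Finset (Fin n))) (x : Fin n) : Linked p x x := by
  obtain ⟨V, hV, hx⟩ := p.exists_mem (mem_univ x)
  exact ⟨V, hV, hx, hx⟩

theorem Linked.trans {p : Finpartition (univ : Finset (Fin n))} {x y z : Fin n}
    (h : Linked p x y) (h' : Linked p y z) : Linked p x z := by
  obtain ⟨V, hV, hx, hy⟩ := h
  obtain ⟨V', hV', hy', hz⟩ := h'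
  obtain rfl := p.eq_of_mem_parts hV hV' hy hy'
  exact ⟨V, hV, hx, hz⟩

/-- The half-open interval `(i, j]` is a union of blocks of `p`. -/
def IntervalSaturated (p : Finpartition (univ : Finset (Fin n))) (i j : Fin n) : Prop :=
  ∀ x y, Linked p x y → i < x → x ≤ j → i < y ∧ y ≤ j

/-- Since $\bar i$ comes just after $i$ and $\bar j$ just after $j$, the unbarred points between
$\bar i$ and $\bar j$ are those of $(i,j]$. A block of $p$ leaving this interval would cross the
block of $q$ through $\bar i$ and $\bar j$. -/
theorem UnionNonCrossing.intervalSaturated {p q : Finpartition (univ : Finset (Fin n))}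
    (hq : UnionNonCrossing p q) {i j : Fin n} (hl : Linked q i j) :
    IntervalSaturated p i j := by
  intro x y hxy hix hxj
  simp only [Fin.lt_def, Fin.le_def] at *
  by_contra hcon
  have : (y : ℕ) ≤ i ∨ (j : ℕ) < y := by omega
  rcases this with h | h
  · have := hq (Sum.inl y) (Sum.inr i) (Sum.inl x) (Sum.inr j)
      (by simp [interleave]; omega) (by simp [interleave]; omega)
      (by simp [interleave]; omega) (Sum.LiftRel.inl hxy.symm) (Sum.LiftRel.inr hl)
    simp at this
  · have := hq (Sum.inr i) (Sum.inl x) (Sum.inr j) (Sum.inl y)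
      (by simp [interleave]; omega) (by simp [interleave]; omega)
      (by simp [interleave]; omega) (Sum.LiftRel.inr hl) (Sum.LiftRel.inl hxy)
    simp at this

theorem unionNonCrossing_kreweras (p : NC n) : UnionNonCrossing p.1 (kreweras p).1 :=
  (kreweras_isGreatest p).1

theorem linked_kreweras_of_unionNonCrossing (p : NC n)
    {q : Finpartition (univ : Finset (Fin n))} (hq : UnionNonCrossing p.1 q) {i j : Fin n}
    (h : Linked q i j) : Linked (kreweras p).1 i j := by
  obtain ⟨V, hV, hi, hj⟩ := h
  obtain ⟨W, hW, hVW⟩ := (kreweras_isGreatest p).2 hq hV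
  exact ⟨W, hW, hVW hi, hVW hj⟩

/-- The relation "the interval between $i$ and $j$ is a union of blocks of $p$" is an equivalence
whose classes form a partition compatible with $p$. Maximality of $\mathrm{Kr}(p)$ then gives the
link. Together with `UnionNonCrossing.intervalSaturated` this describes $\mathrm{Kr}(p)$ explicitly.
-/
theorem linked_kreweras_of_intervalSaturated (p : NC n) {i j : Fin n} (hij : i < j)
    (h : IntervalSaturated p.1 i j) : Linked (kreweras p).1 i j := by
  classical
  -- The equivalence `x ≤ i ↔ x ≤ j` fails exactly for $x$ in $(i,j]$ or $(j,i]$, which treats both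
  -- orders of $i,j$ at once and makes transitivity propositional.
  let R : Fin n → Fin n → Prop := fun i j =>
    ∀ x y, Linked p.1 x y → ((x ≤ i ↔ x ≤ j) ↔ (y ≤ i ↔ y ≤ j))
  let s : Setoid (Fin n) :=
    { r := R
      iseqv :=
        { refl := fun i x y _ => by tauto
          symm := fun {i j} h x y hxy => by have := h x y hxy; tauto
          trans := fun {i j l} h h' x y hxy => by
            have := h x y hxy
            have := h' x y hxy
            tauto } }
  have hs : ∀ i j, Linked (Finpartition.ofSetoid s) i j ↔ R i j := fun i j => by
    rw [linked_iff_mem_part, Finpartition.mem_part_ofSetoid_iff_rel]; rfl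
  refine linked_kreweras_of_unionNonCrossing p (q := Finpartition.ofSetoid s) ?_ ((hs i j).2 ?_)
  · rintro (a | a) (b | b) (c | c) (d | d) hab hbc hcd hac hbd <;>
      simp only [interleave, Sum.elim_inl, Sum.elim_inr] at hab hbc hcd <;>
      simp only [Sum.liftRel_inl_inl, Sum.liftRel_inr_inr, Sum.not_liftRel_inl_inr,
        Sum.not_liftRel_inr_inl, hs] at hac hbd ⊢
    · exact p.2 a b c d (by simp; omega) (by simp; omega) (by simp; omega) hac hbd
    · have := hbd a c hac
      simp only [Fin.le_def] at this
      omega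
    · have := hac b d hbd
      simp only [Fin.le_def] at this
      omega
    -- All four points are barred: $(a,b]=(a,c]\setminus(b,d]$, so $(a,b]$ is a union of blocks if
    -- the other two intervals are.
    · intro x y hxy
      have h1 := hac x y hxy
      have h2 := hbd x y hxy
      simp only [Fin.le_def] at h1 h2 ⊢
      omega
  · intro x y hxy
    have h1 := h x y hxy
    have h2 := h y x hxy.symm
    simp only [Fin.lt_def, Fin.le_def] at *
    omega

/-- No proper nonempty set is both a union of blocks of `p` and a union of blocks of `q`. -/
def JointlyConnected (p q : Finpartition (univ : Finset (Fin n))) : Prop :=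
  ∀ T : Finset (Fin n), (∀ x y, Linked p x y → x ∈ T → y ∈ T) →
    (∀ x y, Linked q x y → x ∈ T → y ∈ T) → T.Nonempty → T = univ

/-- It suffices that $i$ and its successor $s=i+1$ always lie in $T$ together. They are joined by at
most one link of $p$ and one of $\mathrm{Kr}(p)$, found by looking at the block of $s$ in $p$. -/
theorem jointlyConnected_kreweras (p : NC n) : JointlyConnected p.1 (kreweras p).1 := by
  classical
  intro T hp hq hT
  have hp' : ∀ x y, Linked p.1 x y → (x ∈ T ↔ y ∈ T) :=
    fun x y h => ⟨hp x y h, hp y x h.symm⟩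
  have hq' : ∀ x y, Linked (kreweras p).1 x y → (x ∈ T ↔ y ∈ T) :=
    fun x y h => ⟨hq x y h, hq y x h.symm⟩
  have hstep : ∀ i s : Fin n, (s : ℕ) = i + 1 → (i ∈ T ↔ s ∈ T) := by
    intro i s his
    by_cases hr : ∃ r, r < s ∧ Linked p.1 r s
    -- Here $r$ is the predecessor of $s$ in its block. No block of $p$ can leave the gap $(r,i]$,
    -- so $\bar r$ and $\bar i$ are linked unless $r=i$.
    · obtain ⟨r, hr, hmax⟩ := (univ.filter fun r => r < s ∧ Linked p.1 r s).exists_maximal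
        (by obtain ⟨r, h⟩ := hr; exact ⟨r, by simpa using h⟩)
      simp only [mem_filter, mem_univ, true_and] at hr hmax
      rw [← hp' r s hr.2]
      by_cases hri : r = i
      · rw [hri]
      refine (hq' r i (linked_kreweras_of_intervalSaturated p ?_ fun x y hxy hx hxi => ?_)).symm
      · simp only [Fin.lt_def, ← Fin.val_inj] at *; omega
      · have hxs : ¬ Linked p.1 x s := fun h => by
          have := hmax ⟨by simp only [Fin.lt_def, Fin.le_def] at *; omega, h⟩ hx.le
          exact absurd hx (not_lt.2 this)
        have hrx : ¬ Linked p.1 r x := fun h => hxs (h.symm.trans hr.2)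
        by_contra hcon
        have hyr : y ≠ r := fun h => hrx (h ▸ hxy.symm)
        have hys : y ≠ s := fun h => hxs (h ▸ hxy)
        obtain h | h : y < r ∨ s < y := by
          simp only [Fin.lt_def, Fin.le_def, ne_eq, ← Fin.val_inj] at *; omega
        · exact hrx ((p.2 y r x s h hx (by simp only [Fin.le_def] at *; omega)
            hxy.symm hr.2).symm.trans hxy.symm)
        · exact hrx (p.2 r x s y hx (by simp only [Fin.le_def] at *; omega) h hr.2 hxy)
    -- Now $s$ is the minimum of its block and $t$ is the maximum. The interval $(i,t]=[s,t]$ is a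
    -- union of blocks, so $\bar i$ and $\bar t$ are linked.
    · obtain ⟨t, ht, hmax⟩ := (univ.filter fun t => Linked p.1 s t).exists_maximal
        ⟨s, by simpa using Linked.refl _ _⟩
      simp only [mem_filter, mem_univ, true_and] at ht hmax
      have hst : s ≤ t := not_lt.1 fun h => hr ⟨t, h, ht.symm⟩
      rw [hp' s t ht]
      refine hq' i t (linked_kreweras_of_intervalSaturated p ?_ fun x y hxy hx hxt => ?_)
      · simp only [Fin.lt_def, Fin.le_def] at *; omega
      · by_contra hcon
        have hys : ¬ Linked p.1 s y := fun hsy => by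
          have h1 : s ≤ y := not_lt.1 fun h => hr ⟨y, h, hsy.symm⟩
          have h2 : y ≤ t := by
            rcases le_total y t with h | h
            · exact h
            · exact hmax hsy h
          exact hcon ⟨by simp only [Fin.lt_def, Fin.le_def] at *; omega, h2⟩
        have hxs : ¬ Linked p.1 s x := fun h => hys (h.trans hxy)
        have hxs' : x ≠ s := fun h => hxs (h ▸ Linked.refl _ _)
        have hxt' : x ≠ t := fun h => hxs (h ▸ ht)
        have hsx : s < x := by
          simp only [Fin.lt_def, ne_eq, ← Fin.val_inj] at *; omega
        have hxt'' : x < t := lt_of_le_of_ne hxt hxt'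
        obtain h | h : y < s ∨ t < y := by
          simp only [Fin.lt_def, Fin.le_def] at *; omega
        · exact hys (p.2 y s x t h hsx hxt'' hxy.symm ht).symm
        · exact hxs (p.2 s x t y hsx hxt'' h ht hxy)
  have hall : ∀ m (hm : m < n) (h0 : 0 < n), ((⟨m, hm⟩ : Fin n) ∈ T ↔ (⟨0, h0⟩ : Fin n) ∈ T) := by
    intro m
    induction m with
    | zero => intro _ _; rfl
    | succ m ih => intro hm h0; rw [← ih (by omega) h0, hstep ⟨m, by omega⟩ ⟨m + 1, hm⟩ rfl]
  obtain ⟨t, ht⟩ := hT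
  have h0 : 0 < n := t.pos
  refine eq_univ_of_forall fun x => ?_
  rw [← Fin.eta x x.2, hall x x.2 h0, ← hall t t.2 h0]
  exact ht

/-- By maximality $q$ refines $\mathrm{Kr}(p)$. If $q$ split a block $K$ of $\mathrm{Kr}(p)$, the
points of $K$ would cut $[n]$ cyclically into arcs, one for each point of $K$, and neither $p$ nor
the blocks of $q$ outside $K$ could link different arcs. The arcs of a single block of $q$ inside
$K$ would then form a proper subset closed under both $p$ and $q$. -/
theorem eq_kreweras_of_jointlyConnected (p : NC n) {q : Finpartition (univ : Finset (Fin n))}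
    (hq : UnionNonCrossing p.1 q) (hcon : JointlyConnected p.1 q) : q = (kreweras p).1 := by
  classical
  have hle := fun {i j} => linked_kreweras_of_unionNonCrossing p hq (i := i) (j := j)
  have hge : ∀ i j, Linked (kreweras p).1 i j → Linked q i j := by
    intro i j hij
    set K := fun k => Linked (kreweras p).1 i k with hK
    have hKK : ∀ {k k'}, K k → K k' → Linked (kreweras p).1 k k' := fun h h' => h.symm.trans h'
    -- `E x y` says that $x$ and $y$ lie in the same arc. The arcs are closed on the right, so two
    -- different points of $K$ are never in the same one.
    let E : Fin n → Fin n → Prop := fun x y =>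
      ∀ k k', k < k' → K k → K k' → ((k < x ∧ x ≤ k') ↔ (k < y ∧ y ≤ k'))
    have hEK : ∀ x y, K x → K y → E x y → x = y := by
      intro x y hx hy hE
      rcases lt_trichotomy x y with h | h | h
      · exact absurd ((hE x y h hx hy).2 ⟨h, le_rfl⟩).1 (lt_irrefl _)
      · exact h
      · exact absurd ((hE y x h hy hx).1 ⟨h, le_rfl⟩).1 (lt_irrefl _)
    have hEp : ∀ x y, Linked p.1 x y → E x y := by
      intro x y hxy k k' _ hk hk'
      have hs := (unionNonCrossing_kreweras p).intervalSaturated (hKK hk hk')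
      exact ⟨fun h => hs x y hxy h.1 h.2, fun h => hs y x hxy.symm h.1 h.2⟩
    -- A block of $\mathrm{Kr}(p)$ other than $K$ stays within one arc, since otherwise it would
    -- cross $K$.
    have hcross : ∀ x y, Linked (kreweras p).1 x y → ¬ K x → ∀ k k', k < k' → K k → K k' →
        k < x → x ≤ k' → k < y ∧ y ≤ k' := by
      intro x y hxy hx k k' _ hk hk' h1 h2
      have hy : ¬ K y := fun h => hx (h.trans hxy.symm)
      have hxk' : x < k' := lt_of_le_of_ne h2 fun h => hx (h ▸ hk')
      by_contra hc
      have hyk : y ≠ k := fun h => hy (h ▸ hk)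
      obtain h | h : y < k ∨ k' < y := by
        simp only [Fin.lt_def, Fin.le_def, ne_eq, ← Fin.val_inj] at *; omega
      · exact hy (hk.trans ((kreweras p).2 y k x k' h h1 hxk' hxy.symm (hKK hk hk')).symm)
      · exact hx (hk.trans ((kreweras p).2 k x k' y h1 hxk' h (hKK hk hk') hxy))
    have hEq : ∀ x y, Linked q x y → ¬ K x → E x y := by
      intro x y hxy hx k k' hkk hk hk'
      have hy : ¬ K y := fun h => hx (h.trans (hle hxy).symm)
      exact ⟨fun h => hcross x y (hle hxy) hx k k' hkk hk hk' h.1 h.2,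
        fun h => hcross y x (hle hxy).symm hy k k' hkk hk hk' h.1 h.2⟩
    have hEtrans : ∀ x y z, E x y → E z x → E z y := fun x y z h h' k k' hkk hk hk' =>
      (h' k k' hkk hk hk').trans (h k k' hkk hk hk')
    have hEsymm : ∀ x y, E x y → E y x := fun x y h k k' hkk hk hk' => (h k k' hkk hk hk').symm
    -- The set is the union of the arcs through points of the $q$-block of $i$. Once it is
    -- everything, $j$ shares its arc with some $k$ in that block, and $j=k$ because both lie in
    -- $K$.
    have key := hcon (univ.filter fun x => ∃ k, Linked q i k ∧ E x k) ?_ ?_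
      ⟨i, mem_filter.2 ⟨mem_univ i, i, Linked.refl _ _, fun _ _ _ _ _ => Iff.rfl⟩⟩
    · have hj := key ▸ mem_univ j
      obtain ⟨k, hk, hE⟩ := (mem_filter.1 hj).2
      rwa [hEK j k hij (hle hk) hE]
    · intro x y hxy hx
      obtain ⟨k, hk, hE⟩ := (mem_filter.1 hx).2
      exact mem_filter.2 ⟨mem_univ y, k, hk, hEtrans _ _ _ hE (hEsymm _ _ (hEp x y hxy))⟩
    · intro x y hxy hx
      obtain ⟨k, hk, hE⟩ := (mem_filter.1 hx).2
      refine mem_filter.2 ⟨mem_univ y, ?_⟩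
      by_cases hxK : K x
      · have := hEK x k hxK (hle hk) hE
        exact ⟨y, hk.trans (this ▸ hxy), fun _ _ _ _ _ => Iff.rfl⟩
      · exact ⟨k, hk, hEtrans _ _ _ hE (hEsymm _ _ (hEq x y hxy hxK))⟩
  refine le_antisymm ((kreweras_isGreatest p).2 hq) ?_
  intro V hV
  obtain ⟨i, hi⟩ := (kreweras p).1.nonempty_of_mem_parts hV
  refine ⟨q.part i, Finpartition.part_mem _ |>.2 (mem_univ i), fun j hj => ?_⟩
  rw [← linked_iff_mem_part]
  exact hge i j ⟨V, hV, hi, hj⟩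

end Kreweras

/-! ### Connected partitions all of whose blocks have constant parity -/

section Parity

variable {n : ℕ}

/-- The `i`-th even number. -/
def evenIdx (i : Fin n) : ℕ := 2 * i

/-- The `i`-th odd number. -/
def oddIdx (i : Fin n) : ℕ := 2 * i + 1

theorem evenIdx_strictMono : StrictMono (evenIdx : Fin n → ℕ) := fun i j h => by
  simp only [evenIdx, Fin.lt_def] at *; omega

theorem oddIdx_strictMono : StrictMono (oddIdx : Fin n → ℕ) := fun i j h => by
  simp only [oddIdx, Fin.lt_def] at *; omega

/-- The partition `p ∪ q` of `{0, …, 2n - 1}`, with `p` on the even and `q` on the odd numbers. -/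
def interleaveBlocks (p q : Finpartition (univ : Finset (Fin n))) : Finset (Finset ℕ) :=
  blocksImage evenIdx p ∪ blocksImage oddIdx q

theorem evenIdx_image_ne_oddIdx_image {V V' : Finset (Fin n)} (hV : V.Nonempty) :
    V.image evenIdx ≠ V'.image oddIdx := by
  intro h
  obtain ⟨i, hi⟩ := hV
  have := h ▸ mem_image_of_mem evenIdx hi
  obtain ⟨j, -, hj⟩ := mem_image.1 this
  simp only [evenIdx, oddIdx] at hj
  omega

theorem disjoint_blocksImage (p q : Finpartition (univ : Finset (Fin n))) :
    Disjoint (blocksImage evenIdx p) (blocksImage oddIdx q) := by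
  refine disjoint_left.2 fun B hB hB' => ?_
  obtain ⟨V, hV, rfl⟩ := mem_blocksImage.1 hB
  obtain ⟨V', hV', h⟩ := mem_blocksImage.1 hB'
  exact evenIdx_image_ne_oddIdx_image (p.nonempty_of_mem_parts hV) h.symm

theorem evenIdx_mem_dbl (i : Fin n) : evenIdx i ∈ dbl (range n) :=
  mem_dbl.2 (mem_range.2 (by simp only [evenIdx]; omega))

theorem oddIdx_mem_dbl (i : Fin n) : oddIdx i ∈ dbl (range n) :=
  mem_dbl.2 (mem_range.2 (by simp only [oddIdx]; omega))

theorem isNCPartition_interleaveBlocks (p q : NC n) (h : UnionNonCrossing p.1 q.1) :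
    IsNCPartition (dbl (range n)) (interleaveBlocks p.1 q.1) := by
  have hp := isNCPartition_blocksImage evenIdx_strictMono p
  have hq := isNCPartition_blocksImage oddIdx_strictMono q
  have hparity : ∀ B ∈ blocksImage evenIdx p.1, ∀ B' ∈ blocksImage oddIdx q.1, ∀ x, x ∈ B →
      x ∈ B' → False := by
    intro B hB B' hB' x hx hx'
    obtain ⟨i, -, rfl⟩ := mem_image.1 (hp.subset B hB hx)
    obtain ⟨j, -, hj⟩ := mem_image.1 (hq.subset B' hB' hx')
    simp only [evenIdx, oddIdx] at hj
    omega
  have hlink : ∀ {e : Fin n → ℕ} (he : StrictMono e) (r : NC n), ∀ B ∈ blocksImage e r.1, ∀ x ∈ B,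
      ∀ y ∈ B, ∃ i j, e i = x ∧ e j = y ∧ Linked r.1 i j := by
    intro e he r B hB x hx y hy
    obtain ⟨V, hV, rfl⟩ := mem_blocksImage.1 hB
    obtain ⟨i, hi, rfl⟩ := mem_image.1 hx
    obtain ⟨j, hj, rfl⟩ := mem_image.1 hy
    exact ⟨i, j, rfl, rfl, V, hV, hi, hj⟩
  refine ⟨?_, ?_, ?_, ?_, ?_⟩
  · intro B hB
    exact (mem_union.1 hB).elim (hp.nonempty B) (hq.nonempty B)
  · intro B hB x hx
    rcases mem_union.1 hB with hB | hB
    · obtain ⟨i, -, rfl⟩ := mem_image.1 (hp.subset B hB hx)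
      exact evenIdx_mem_dbl i
    · obtain ⟨i, -, rfl⟩ := mem_image.1 (hq.subset B hB hx)
      exact oddIdx_mem_dbl i
  · intro x hx
    have hx := mem_range.1 (mem_dbl.1 hx)
    rcases Nat.even_or_odd' x with ⟨c, hc | hc⟩
    · obtain ⟨B, hB, hxB⟩ := hp.cover x (mem_image.2
        ⟨⟨c, by omega⟩, mem_univ _, by simp only [evenIdx]; omega⟩)
      exact ⟨B, mem_union_left _ hB, hxB⟩
    · obtain ⟨B, hB, hxB⟩ := hq.cover x (mem_image.2
        ⟨⟨c, by omega⟩, mem_univ _, by simp only [oddIdx]; omega⟩)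
      exact ⟨B, mem_union_right _ hB, hxB⟩
  · intro B hB B' hB' x hx hx'
    rcases mem_union.1 hB with hB | hB <;> rcases mem_union.1 hB' with hB' | hB'
    · exact hp.disj B hB B' hB' x hx hx'
    · exact (hparity B hB B' hB' x hx hx').elim
    · exact (hparity B' hB' B hB x hx' hx).elim
    · exact hq.disj B hB B' hB' x hx hx'
  · intro B hB B' hB' a b c d hab hbc hcd ha hc hb hd
    rcases mem_union.1 hB with hB | hB <;> rcases mem_union.1 hB' with hB' | hB'
    · exact hp.nc B hB B' hB' a b c d hab hbc hcd ha hc hb hd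
    · obtain ⟨a, c, rfl, rfl, hac⟩ := hlink evenIdx_strictMono p B hB a ha c hc
      obtain ⟨b, d, rfl, rfl, hbd⟩ := hlink oddIdx_strictMono q B' hB' b hb d hd
      have := h (Sum.inl a) (Sum.inr b) (Sum.inl c) (Sum.inr d) hab hbc hcd
        (Sum.LiftRel.inl hac) (Sum.LiftRel.inr hbd)
      simp at this
    · obtain ⟨a, c, rfl, rfl, hac⟩ := hlink oddIdx_strictMono q B hB a ha c hc
      obtain ⟨b, d, rfl, rfl, hbd⟩ := hlink evenIdx_strictMono p B' hB' b hb d hd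
      have := h (Sum.inr a) (Sum.inl b) (Sum.inr c) (Sum.inl d) hab hbc hcd
        (Sum.LiftRel.inr hac) (Sum.LiftRel.inl hbd)
      simp at this
    · exact hq.nc B hB B' hB' a b c d hab hbc hcd ha hc hb hd

theorem linked_of_interleaveBlocks {p q : Finpartition (univ : Finset (Fin n))} {C}
    (hC : interleaveBlocks p q = C) {i j : Fin n} :
    (Linked p i j → ∃ B ∈ C, evenIdx i ∈ B ∧ evenIdx j ∈ B) ∧
      (Linked q i j → ∃ B ∈ C, oddIdx i ∈ B ∧ oddIdx j ∈ B) := by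
  subst hC
  constructor
  · rintro ⟨V, hV, hi, hj⟩
    exact ⟨_, mem_union_left _ (mem_blocksImage.2 ⟨V, hV, rfl⟩), mem_image_of_mem _ hi,
      mem_image_of_mem _ hj⟩
  · rintro ⟨V, hV, hi, hj⟩
    exact ⟨_, mem_union_right _ (mem_blocksImage.2 ⟨V, hV, rfl⟩), mem_image_of_mem _ hi,
      mem_image_of_mem _ hj⟩

theorem unionNonCrossing_of_interleaveBlocks {p q : NC n} {S : Finset ℕ}
    (hC : IsNCPartition S (interleaveBlocks p.1 q.1)) : UnionNonCrossing p.1 q.1 := by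
  have hne : ∀ B ∈ blocksImage evenIdx p.1, ∀ B' ∈ blocksImage oddIdx q.1, B ≠ B' :=
    fun B hB B' hB' h => disjoint_left.1 (disjoint_blocksImage p.1 q.1) hB (h ▸ hB')
  have hp : ∀ {i j}, Linked p.1 i j →
      ∃ B ∈ blocksImage evenIdx p.1, evenIdx i ∈ B ∧ evenIdx j ∈ B := fun ⟨V, hV, hi, hj⟩ =>
    ⟨_, mem_blocksImage.2 ⟨V, hV, rfl⟩, mem_image_of_mem _ hi, mem_image_of_mem _ hj⟩
  have hq : ∀ {i j}, Linked q.1 i j →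
      ∃ B ∈ blocksImage oddIdx q.1, oddIdx i ∈ B ∧ oddIdx j ∈ B := fun ⟨V, hV, hi, hj⟩ =>
    ⟨_, mem_blocksImage.2 ⟨V, hV, rfl⟩, mem_image_of_mem _ hi, mem_image_of_mem _ hj⟩
  rintro a b c d hab hbc hcd (@⟨a, c, hac⟩ | @⟨a, c, hac⟩) (@⟨b, d, hbd⟩ | @⟨b, d, hbd⟩)
  · refine Sum.LiftRel.inl (p.2 a b c d ?_ ?_ ?_ hac hbd) <;>
      simp only [interleave, Sum.elim_inl] at * <;> omega
  · obtain ⟨B, hB, ha, hc⟩ := hp hac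
    obtain ⟨B', hB', hb, hd⟩ := hq hbd
    exact (hne B hB B' hB' (hC.nc B (mem_union_left _ hB) B' (mem_union_right _ hB') _ _ _ _
      hab hbc hcd ha hc hb hd)).elim
  · obtain ⟨B, hB, ha, hc⟩ := hq hac
    obtain ⟨B', hB', hb, hd⟩ := hp hbd
    exact (hne B' hB' B hB (hC.nc B (mem_union_right _ hB) B' (mem_union_left _ hB') _ _ _ _
      hab hbc hcd ha hc hb hd).symm).elim
  · refine Sum.LiftRel.inr (q.2 a b c d ?_ ?_ ?_ hac hbd) <;>
      simp only [interleave, Sum.elim_inr] at * <;> omega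

/-- Halving sends $2i$ and $2i+1$ to the same $i$, so a set is saturated for $p\cup q$ exactly when
it is closed under the links of $p$ and those of $q$. -/
theorem connects_interleaveBlocks_iff {p q : Finpartition (univ : Finset (Fin n))} :
    Connects (interleaveBlocks p q) (range n) ↔ JointlyConnected p q := by
  classical
  constructor
  · intro h T hTp hTq ⟨t, ht⟩
    have key := h (T.image fun i : Fin n => (i : ℕ)) (fun x hx => ?_) ?_ ⟨t, mem_image_of_mem _ ht⟩
    · refine eq_univ_of_forall fun i => ?_
      obtain ⟨j, hj, hji⟩ := mem_image.1 (key ▸ mem_range.2 i.2)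
      rwa [← Fin.ext hji]
    · obtain ⟨i, -, rfl⟩ := mem_image.1 hx
      exact mem_range.2 i.2
    · intro B hB x hx y hy hxT
      obtain ⟨l, hl, hlx⟩ := mem_image.1 hxT
      rcases mem_union.1 hB with hB | hB
      · obtain ⟨V, hV, rfl⟩ := mem_blocksImage.1 hB
        obtain ⟨i, hi, rfl⟩ := mem_image.1 hx
        obtain ⟨j, hj, rfl⟩ := mem_image.1 hy
        simp only [evenIdx] at *
        have : l = i := Fin.ext (by omega)
        exact mem_image.2 ⟨j, hTp i j ⟨V, hV, hi, hj⟩ (this ▸ hl), by omega⟩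
      · obtain ⟨V, hV, rfl⟩ := mem_blocksImage.1 hB
        obtain ⟨i, hi, rfl⟩ := mem_image.1 hx
        obtain ⟨j, hj, rfl⟩ := mem_image.1 hy
        simp only [oddIdx] at *
        have : l = i := Fin.ext (by omega)
        exact mem_image.2 ⟨j, hTq i j ⟨V, hV, hi, hj⟩ (this ▸ hl), by omega⟩
  · intro h T hT hTc ⟨t, ht⟩
    have key := h (univ.filter fun i : Fin n => (i : ℕ) ∈ T) ?_ ?_
      ⟨⟨t, mem_range.1 (hT ht)⟩, by simpa using ht⟩
    · refine hT.antisymm fun x hx => ?_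
      have := key ▸ mem_univ (⟨x, mem_range.1 hx⟩ : Fin n)
      simpa using this
    · intro x y hxy hx
      obtain ⟨B, hB, hxB, hyB⟩ := (linked_of_interleaveBlocks rfl).1 hxy
      have := hTc B hB _ hxB _ hyB
      simp only [evenIdx, mem_filter, mem_univ, true_and] at *
      rw [show 2 * (x : ℕ) / 2 = x by omega, show 2 * (y : ℕ) / 2 = y by omega] at this
      exact this hx
    · intro x y hxy hx
      obtain ⟨B, hB, hxB, hyB⟩ := (linked_of_interleaveBlocks rfl).2 hxy
      have := hTc B hB _ hxB _ hyB
      simp only [oddIdx, mem_filter, mem_univ, true_and] at *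
      rw [show (2 * (x : ℕ) + 1) / 2 = x by omega,
        show (2 * (y : ℕ) + 1) / 2 = y by omega] at this
      exact this hx

theorem interleaveBlocks_kreweras_mem (p : NC n) :
    interleaveBlocks p.1 (kreweras p).1 ∈ connectedPartitions (range n) :=
  mem_connectedPartitions.2
    ⟨isNCPartition_interleaveBlocks p _ (unionNonCrossing_kreweras p),
      connects_interleaveBlocks_iff.2 (jointlyConnected_kreweras p)⟩

/-- This recovers $p$ from $p\cup q$, so that distinct $p$ index distinct terms of the sum. -/
theorem filter_interleaveBlocks (p q : Finpartition (univ : Finset (Fin n))) :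
    (interleaveBlocks p q).filter (· ⊆ univ.image (evenIdx : Fin n → ℕ)) = blocksImage evenIdx p := by
  ext B
  rw [mem_filter]
  constructor
  · rintro ⟨hB, hsub⟩
    refine (mem_union.1 hB).resolve_right fun hB => ?_
    obtain ⟨V, hV, rfl⟩ := mem_blocksImage.1 hB
    obtain ⟨i, hi⟩ := q.nonempty_of_mem_parts hV
    obtain ⟨j, -, hj⟩ := mem_image.1 (hsub (mem_image_of_mem _ hi))
    simp only [evenIdx, oddIdx] at hj
    omega
  · intro hB
    refine ⟨mem_union_left _ hB, ?_⟩
    obtain ⟨V, hV, rfl⟩ := mem_blocksImage.1 hB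
    exact image_subset_image (subset_univ V)

theorem interleaveBlocks_kreweras_injective :
    Function.Injective fun p : NC n => interleaveBlocks p.1 (kreweras p).1 := by
  intro p p' h
  have h := congrArg (fun C => C.filter (· ⊆ univ.image (evenIdx : Fin n → ℕ))) h
  simp only [filter_interleaveBlocks] at h
  exact Subtype.ext (blocksImage_injective evenIdx_strictMono h)

/-- A connected partition whose blocks have constant parity is `p ∪ Kr(p)` for some `p`. -/
theorem exists_eq_interleaveBlocks_kreweras {C : Finset (Finset ℕ)}
    (hC : C ∈ connectedPartitions (range n))
    (hpar : ∀ B ∈ C, ∀ x ∈ B, ∀ y ∈ B, x % 2 = y % 2) :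
    ∃ p : NC n, interleaveBlocks p.1 (kreweras p).1 = C := by
  obtain ⟨hC, hcon⟩ := mem_connectedPartitions.1 hC
  have hsub : ∀ B ∈ C, B ⊆ univ.image (evenIdx : Fin n → ℕ) ∨
      B ⊆ univ.image (oddIdx : Fin n → ℕ) := by
    intro B hB
    obtain ⟨x, hx⟩ := hC.nonempty B hB
    have hlt : ∀ y ∈ B, y / 2 < n := fun y hy => mem_range.1 (mem_dbl.1 (hC.subset B hB hy))
    rcases Nat.mod_two_eq_zero_or_one x with h | h
    · refine Or.inl fun y hy => mem_image.2 ⟨⟨y / 2, hlt y hy⟩, mem_univ _, ?_⟩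
      have := hpar B hB x hx y hy
      simp only [evenIdx]
      omega
    · refine Or.inr fun y hy => mem_image.2 ⟨⟨y / 2, hlt y hy⟩, mem_univ _, ?_⟩
      have := hpar B hB x hx y hy
      simp only [oddIdx]
      omega
  -- Each parity class is a union of blocks of $C$, so the blocks inside it pull back to a
  -- non-crossing partition of $[n]$.
  have hpull : ∀ e : Fin n → ℕ, StrictMono e → (∀ i, e i ∈ dbl (range n)) →
      (∀ B ∈ C, ∀ i, e i ∈ B → B ⊆ univ.image e) →
      ∃ p : NC n, blocksImage e p.1 = C.filter (· ⊆ univ.image e) := by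
    intro e he hmem hB
    refine exists_NC_of_blocks he hC (filter_subset _ _) (fun B hB => (mem_filter.1 hB).2)
      fun i => ?_
    obtain ⟨B, hBC, hi⟩ := hC.cover _ (hmem i)
    exact ⟨B, mem_filter.2 ⟨hBC, hB B hBC i hi⟩, hi⟩
  obtain ⟨p, hp⟩ := hpull evenIdx evenIdx_strictMono evenIdx_mem_dbl fun B hB i hi =>
    (hsub B hB).resolve_right fun h => by
      obtain ⟨j, -, hj⟩ := mem_image.1 (h hi)
      simp only [evenIdx, oddIdx] at hj
      omega
  obtain ⟨q, hq⟩ := hpull oddIdx oddIdx_strictMono oddIdx_mem_dbl fun B hB i hi =>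
    (hsub B hB).resolve_left fun h => by
      obtain ⟨j, -, hj⟩ := mem_image.1 (h hi)
      simp only [evenIdx, oddIdx] at hj
      omega
  have hpq : interleaveBlocks p.1 q.1 = C := by
    rw [interleaveBlocks, hp, hq, ← filter_or]
    exact filter_true_of_mem hsub
  subst hpq
  exact ⟨p, by
    rw [← eq_kreweras_of_jointlyConnected p (unionNonCrossing_of_interleaveBlocks hC)
      (connects_interleaveBlocks_iff.1 hcon)]⟩

end Parity

/-! ### Vanishing of mixed cumulants and the product formula -/

section Products

variable {k : ℕ} {A : Type*} [Ring A] [Algebra ℂ A] (φ : A →ₗ[ℂ] CAlg k)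

theorem cumulantOn_eq_zero_of_parity {M₁ M₂ : Set A} (hfree : InfinitesimallyFree φ ![M₁, M₂])
    {x : ℕ → A} (hx₁ : ∀ i, x (2 * i) ∈ M₁) (hx₂ : ∀ i, x (2 * i + 1) ∈ M₂) {B : Finset ℕ}
    {s t : ℕ} (hs : s ∈ B) (ht : t ∈ B) (hst : s % 2 ≠ t % 2) : cumulantOn φ x B = 0 := by
  have key : ∀ s t, s < t → s ∈ B → t ∈ B → s % 2 ≠ t % 2 → cumulantOn φ x B = 0 := by
    intro s t hlt hs ht hst
    rw [← Finset.mem_coe, ← Finset.range_orderEmbOfFin B rfl] at hs ht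
    obtain ⟨i, rfl⟩ := hs
    obtain ⟨j, rfl⟩ := ht
    -- Each entry is assigned to $M_1$ or $M_2$ by the parity of its position. The positions $s$ and
    -- $t$ show that both labels occur.
    refine hfree _ (fun l => if B.orderEmbOfFin rfl l % 2 = 0 then 0 else 1) _ (fun l => ?_)
      ⟨i, j, (B.orderEmbOfFin rfl).lt_iff_lt.1 hlt, fun h => ?_⟩
    · split_ifs with h
      · have := hx₁ (B.orderEmbOfFin rfl l / 2)
        rwa [show 2 * (B.orderEmbOfFin rfl l / 2) = B.orderEmbOfFin rfl l by omega] at this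
      · have := hx₂ (B.orderEmbOfFin rfl l / 2)
        rwa [show 2 * (B.orderEmbOfFin rfl l / 2) + 1 = B.orderEmbOfFin rfl l by omega] at this
    · split_ifs at h
      · omega
      · exact absurd h (by decide)
      · exact absurd h (by decide)
      · omega
  rcases lt_or_gt_of_ne (show s ≠ t by rintro rfl; exact hst rfl) with h | h
  · exact key s t h hs ht hst
  · exact key t s h ht hs hst.symm

theorem cumulant_mul_of_sequence {M₁ M₂ : Set A} (hfree : InfinitesimallyFree φ ![M₁, M₂])
    {x : ℕ → A} (hx₁ : ∀ i, x (2 * i) ∈ M₁) (hx₂ : ∀ i, x (2 * i + 1) ∈ M₂) {n : ℕ}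
    (hn : 1 ≤ n) :
    cumulant φ n (fun i => x (evenIdx i) * x (oddIdx i)) = ∑ p : NC n,
      multPart (cumulant φ) p (fun i => x (evenIdx i))
        * multPart (cumulant φ) (kreweras p) (fun i => x (oddIdx i)) := by
  have hrange : univ.image (fun i : Fin n => (i : ℕ)) = range n := by
    ext i
    simp only [mem_image, mem_univ, true_and, mem_range]
    exact ⟨fun ⟨j, hj⟩ => hj ▸ j.2, fun h => ⟨⟨i, h⟩, rfl⟩⟩
  have h1 := cumulantOn_image φ (e := fun i : Fin n => (i : ℕ)) (fun i j h => h)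
    (fun i => x (2 * i) * x (2 * i + 1))
  rw [hrange, cumulantOn_mul φ x ⟨0, mem_range.2 hn⟩] at h1
  refine h1.symm.trans (Eq.symm ?_)
  -- The map $p\mapsto p\cup\mathrm{Kr}(p)$ is injective into the connected partitions. A connected
  -- partition outside its image has a block of mixed parity, so its term is zero.
  refine Finset.sum_of_injOn (fun p : NC n => interleaveBlocks p.1 (kreweras p).1)
    interleaveBlocks_kreweras_injective.injOn (fun p _ => interleaveBlocks_kreweras_mem p) ?_ ?_
  · intro C hC hnot
    by_contra hne
    obtain ⟨p, hp⟩ := exists_eq_interleaveBlocks_kreweras hC fun B hB s hs t ht => by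
      by_contra hst
      exact hne (Finset.prod_eq_zero hB (cumulantOn_eq_zero_of_parity φ hfree hx₁ hx₂ hs ht hst))
    exact hnot ⟨p, mem_coe.2 (mem_univ p), hp⟩
  · intro p _
    rw [interleaveBlocks, Finset.prod_union (disjoint_blocksImage _ _), multPart_apply,
      multPart_apply, blocksImage, blocksImage,
      Finset.prod_image fun V _ V' _ h => image_injective evenIdx_strictMono.injective h,
      Finset.prod_image fun V _ V' _ h => image_injective oddIdx_strictMono.injective h]
    congr 1
    · exact Finset.prod_congr rfl fun V _ =>
        (cumulantOn_image_block φ evenIdx_strictMono x V).symm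
    · exact Finset.prod_congr rfl fun V _ =>
        (cumulantOn_image_block φ oddIdx_strictMono x V).symm

end Products

/-- `(A, φ)` is a scarce `𝒞_k`-noncommutative probability space: `A` is a unital complex algebra and
`φ : A → 𝒞_k` is linear with `φ 1 = 1`. -/
theorem mainTheorem7 (k : ℕ) {A : Type*} [Ring A] [Algebra ℂ A]
    (φ : A →ₗ[ℂ] CAlg k) (hφ : φ 1 = 1)
    (M₁ M₂ : Set A) (hfree : InfinitesimallyFree φ ![M₁, M₂])
    (n : ℕ) (hn : 1 ≤ n) (a b : Fin n → A)
    (ha : ∀ i, a i ∈ M₁) (hb : ∀ i, b i ∈ M₂) :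
    cumulant φ n (fun i => a i * b i) =
      ∑ p : NC n, multPart (cumulant φ) p a * multPart (cumulant φ) (kreweras p) b := by
  -- Positions beyond the range repeat the first entry. The infinite sequence thus stays in $M_1$ at
  -- even and in $M_2$ at odd positions, and the added entries do not enter the formula for $n$.
  let idx : ℕ → Fin n := fun i => if h : i < n then ⟨i, h⟩ else ⟨0, hn⟩
  have hidx : ∀ i : Fin n, idx i = i := fun i => dif_pos i.2
  let x : ℕ → A := fun m => if m % 2 = 0 then a (idx (m / 2)) else b (idx (m / 2))
  have hx₁ : ∀ i, x (2 * i) = a (idx i) := fun i => by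
    simp only [x]
    rw [if_pos (by omega), show 2 * i / 2 = i by omega]
  have hx₂ : ∀ i, x (2 * i + 1) = b (idx i) := fun i => by
    simp only [x]
    rw [if_neg (by omega), show (2 * i + 1) / 2 = i by omega]
  have key := cumulant_mul_of_sequence φ hfree (x := x) (fun i => hx₁ i ▸ ha _)
    (fun i => hx₂ i ▸ hb _) hn
  simpa only [evenIdx, oddIdx, hx₁, hx₂, hidx] using key
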